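/- A best response pattern is a function $T:\mathbb{N}\to\{0,1\}$, where $\mathbb{N}\ni 0$. For a finite simple undirected graph $G=(V,E)$, a profile $s:V\to\{0,1\}$ is a non-trivial pure Nash equilibrium with respect to $T$ if $s_i=T\bigl(|\{j : \{i,j\}\in E,\ s_j=1\}|\bigr)$ for every $i\in V$ and $s_i=1$ for at least one $i\in V$. For fixed $T$, NTPNE$(T)$ is the decision problem whose input is a finite graph $G$ and whose question is whether $G$ has a non-trivial pure Nash equilibrium with respect to $T$. NP-hardness and NP-completeness are meant with respect to polynomial-time many-one reductions. Theorem. Let $T$ be a non-flat pattern, i.e. $T(0)=1$, and let $T'$ be the pattern $1,0$ followed by $T$, i.e. $T'$ is sharp ($T'(0)=1$, $T'(1)=0$) and shifted by $2$ from $T$ ($T'(k+2)=T(k)$ for all $k\in\mathbb{N}$). Then NTPNE$(T)$ is polynomial-time many-one reducible to NTPNE$(T')$. Consequently, if NTPNE$(T)$ is NP-complete, then NTPNE$(T')$ is NP-hard, and it is NP-complete provided that $T(k)$ can be computed in time polynomial in $k$. -/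

import Mathlib

namespace PublicGoods

/-! ### Polynomial time, NP, many-one reductions

Decision problems are languages over `Bool`. Polynomial time is polynomial time on
Mathlib's (multi-stack) Turing machines `Turing.FinTM2`. -/

/-- `f` maps strings to strings and is computable in polynomial time. -/
def PolyTimeFun (f : List Bool → List Bool) : Prop :=
  Nonempty (Turing.TM2ComputableInPolyTime (id : List Bool → List Bool) id f)

/-- A pair of strings as one string over `Bool ⊕ Bool`: the letters of the first component are
tagged by `Sum.inl`, those of the second by `Sum.inr`. -/
def encodePair (p : List Bool × List Bool) : List (Bool ⊕ Bool) :=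
  p.1.map Sum.inl ++ p.2.map Sum.inr

/-- `V` is a predicate on pairs of strings that is decidable in polynomial time. -/
def PolyTimeVerifier (V : List Bool × List Bool → Bool) : Prop :=
  Nonempty (Turing.TM2ComputableInPolyTime encodePair Computability.encodeBool V)

/-- The class NP: membership has polynomially long certificates that can be checked in
polynomial time. -/
def InNP (L : Language Bool) : Prop :=
  ∃ (V : List Bool × List Bool → Bool) (p : Polynomial ℕ), PolyTimeVerifier V ∧
    ∀ x : List Bool, x ∈ L ↔ ∃ w : List Bool, w.length ≤ p.eval x.length ∧ V (x, w) = true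

/-- Polynomial-time many-one reducibility. -/
def PolyTimeReducible (A B : Language Bool) : Prop :=
  ∃ f : List Bool → List Bool, PolyTimeFun f ∧ ∀ x : List Bool, x ∈ A ↔ f x ∈ B

/-- NP-hardness under polynomial-time many-one reductions. -/
def NPHard (B : Language Bool) : Prop :=
  ∀ A : Language Bool, InNP A → PolyTimeReducible A B

/-- NP-completeness under polynomial-time many-one reductions. -/
def NPComplete (B : Language Bool) : Prop :=
  InNP B ∧ NPHard B

/-! ### Best-response patterns and equilibria -/

/-- A best-response pattern: `T k` is the best response of an agent exactly `k` of whose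
neighbours produce the good (`true` means producing it). -/
abbrev Pattern : Type := ℕ → Bool

/-- A flat pattern starts with `0`. -/
def IsFlat (T : Pattern) : Prop := T 0 = false

/-- A sharp pattern starts with `1, 0`. -/
def IsSharp (T : Pattern) : Prop := T 0 = true ∧ T 1 = false

/-- `T'` is shifted by `m` from `T`. -/
def IsShiftedBy (m : ℕ) (T' T : Pattern) : Prop := ∀ k : ℕ, T' (k + m) = T k

/-- The value `T k` is computable in time polynomial in `k`, i.e. in the length of the unary
representation of `k`. -/
def PolyTimePattern (T : Pattern) : Prop :=
  Nonempty (Turing.TM2ComputableInPolyTime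
    Computability.unaryEncodeNat Computability.encodeBool T)

section Game

variable {V : Type} [Fintype V]

open Classical in
/-- The number of neighbours of `i` that produce the good under the profile `s`. -/
noncomputable def supportCount (G : SimpleGraph V) (s : V → Bool) (i : V) : ℕ :=
  (Finset.univ.filter fun j : V => G.Adj i j ∧ s j = true).card

/-- Pure Nash equilibrium: every agent plays the best response. -/
def IsPNE (T : Pattern) (G : SimpleGraph V) (s : V → Bool) : Prop :=
  ∀ i : V, s i = T (supportCount G s i)

/-- Non-trivial pure Nash equilibrium: some agent produces the good. -/
def IsNTPNE (T : Pattern) (G : SimpleGraph V) (s : V → Bool) : Prop :=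
  IsPNE T G s ∧ ∃ i : V, s i = true

end Game

open Classical in
/-- A graph on the vertices `0, …, n - 1` as a string: `n` in unary, the delimiter `0`, and the
rows of the adjacency matrix, one after the other. -/
noncomputable def encodeGraph {n : ℕ} (G : SimpleGraph (Fin n)) : List Bool :=
  List.replicate n true ++ false ::
    (List.finRange n).flatMap fun i => (List.finRange n).map fun j => decide (G.Adj i j)

/-- The decision problem NTPNE(`T`): given a graph, does it have a non-trivial pure Nash
equilibrium with respect to `T`? -/
def NTPNE (T : Pattern) : Language Bool :=
  {x | ∃ (n : ℕ) (G : SimpleGraph (Fin n)), x = encodeGraph G ∧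
    ∃ s : Fin n → Bool, IsNTPNE T G s}

end PublicGoods

/-! The reduction hangs a copy of a fixed seven-vertex gadget on every vertex v of G, with v itself
as vertex 0 of its copy. Whenever the other six vertices of a copy play best responses under `T'`,
exactly two gadget neighbours of v produce, whatever v does; and either strategy of v can be
completed to such responses (`IsGadget`). So a vertex with k producing neighbours in G sees k + 2 in
the new graph, and `T' (k + 2) = T k`: equilibria of the new graph restrict to equilibria of G, and
every equilibrium of G extends (`exists_isNTPNE_attach`). Production in the new graph may take place
only inside the gadgets, so non-triviality on G needs another source: `T 0 = true` excludes the
all-zero profile on a nonempty graph.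

The pattern `T'` starts with 1, 0, 1, the third value being `T 0`, while `T' 3` is unknown. Each of
its two values has its own gadget, `isGadget_tableZero` and `isGadget_tableOne`.

The rest is computability. Polynomial time on stack machines is shown to be closed under
composition, pairing, case distinction and iteration with polynomially bounded intermediate results
(`computable_comp`, `PolyTime.prodMk`, `PolyTime.cond`, `PolyTime.iterate`). These closure
properties rest on `reach_embed`, which runs an arbitrary machine as a subroutine of a larger one.
With a few explicit stack programs as a base, string and unary arithmetic operations follow, and
`fun_prop` assembles them into `polyTime_reduction` and `polyTime_verifier`. Hardness is then
transitivity of reductions. Membership in NP takes the profile as certificate, and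
`computable_tagged` translates between the two encodings of pairs. -/

namespace PublicGoods

open Turing Function

/-! ### Runs of `TM2` machines -/

section Reach

variable {K : Type} [DecidableEq K] {Γ : K → Type} {Λ σ : Type}

/-- `c'` is reached from `c` within `t` steps. -/
def Reach (m : Λ → TM2.Stmt Γ Λ σ) (c c' : TM2.Cfg Γ Λ σ) (t : ℕ) : Prop :=
  ∃ n ≤ t, (flip bind (TM2.step m))^[n] (some c) = some c'

variable {m : Λ → TM2.Stmt Γ Λ σ} {c c' c'' : TM2.Cfg Γ Λ σ} {t t' : ℕ}

theorem Reach.refl (c : TM2.Cfg Γ Λ σ) : Reach m c c 0 := ⟨0, le_rfl, rfl⟩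

theorem Reach.mono (h : Reach m c c' t) (ht : t ≤ t') : Reach m c c' t' :=
  let ⟨n, hn, e⟩ := h
  ⟨n, hn.trans ht, e⟩

theorem Reach.trans (h : Reach m c c' t) (h' : Reach m c' c'' t') : Reach m c c'' (t + t') := by
  obtain ⟨n, hn, e⟩ := h
  obtain ⟨n', hn', e'⟩ := h'
  refine ⟨n' + n, by omega, ?_⟩
  rw [iterate_add_apply, e, e']

theorem Reach.step {l : Λ} {v : σ} {S : ∀ k, List (Γ k)}
    (h : Reach m (TM2.stepAux (m l) v S) c' t) : Reach m ⟨some l, v, S⟩ c' (t + 1) := by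
  obtain ⟨n, hn, e⟩ := h
  exact ⟨n + 1, by omega, e⟩

theorem Reach.step_eq {l : Λ} {v : σ} {S : ∀ k, List (Γ k)} (h : TM2.stepAux (m l) v S = c') :
    Reach m ⟨some l, v, S⟩ c' 1 :=
  Reach.step (t := 0) (h ▸ Reach.refl _)

theorem iterate_step_none (n : ℕ) :
    (flip bind (TM2.step m))^[n] (none : Option (TM2.Cfg Γ Λ σ)) = none := by
  induction n with
  | zero => rfl
  | succ n ih => rw [iterate_succ_apply]; exact ih

/-- The number of pushes in a statement. -/
def pushes : TM2.Stmt Γ Λ σ → ℕ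
  | .push _ _ q => pushes q + 1
  | .peek _ _ q => pushes q
  | .pop _ _ q => pushes q
  | .load _ q => pushes q
  | .branch _ p q => pushes p + pushes q
  | .goto _ => 0
  | .halt => 0

theorem length_stepAux_le (q : TM2.Stmt Γ Λ σ) (v : σ) (S : ∀ k, List (Γ k)) (k : K) :
    ((TM2.stepAux q v S).stk k).length ≤ (S k).length + pushes q := by
  induction q generalizing v S with
  | push k' f q ih =>
    refine (ih _ _).trans ?_
    rcases eq_or_ne k k' with rfl | hk
    · simp [pushes]; omega
    · simp [pushes, update_of_ne hk]
  | peek k' f q ih => exact ih _ _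
  | pop k' f q ih =>
    refine (ih _ _).trans ?_
    rcases eq_or_ne k k' with rfl | hk
    · simp [pushes]
    · simp [pushes, update_of_ne hk]
  | load f q ih => exact ih _ _
  | branch f p q ihp ihq =>
    simp only [TM2.stepAux, pushes]
    cases f v
    · exact (ihq _ _).trans (by omega)
    · exact (ihp _ _).trans (by omega)
  | goto f => simp [pushes]
  | halt => simp [pushes]

theorem length_iterate_le {C : ℕ} (hC : ∀ l, pushes (m l) ≤ C) (n : ℕ)
    (h : (flip bind (TM2.step m))^[n] (some c) = some c') (k : K) :
    (c'.stk k).length ≤ (c.stk k).length + n * C := by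
  induction n generalizing c with
  | zero => cases h; simp
  | succ n ih =>
    rw [iterate_succ_apply] at h
    obtain ⟨_ | l, v, S⟩ := c
    · exact absurd ((iterate_step_none n).symm.trans h) (by simp)
    · refine (ih h).trans ?_
      have := (length_stepAux_le (m l) v S k).trans (Nat.add_le_add_left (hC l) _)
      simp only [Nat.add_mul, one_mul]
      omega

end Reach

/-! ### Machines as subroutines -/

section Embed

variable {K K' : Type} {Γ' : K' → Type} {Λ Λ' σ σ' : Type}

/-- A statement as part of a larger machine: stacks, labels and state are embedded, and halting
becomes a jump to `e`. -/
def embed (ι : K → K') (get : σ' → σ) (set : σ → σ' → σ') (g : Λ → Λ') (e : Λ') :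
    TM2.Stmt (fun k => Γ' (ι k)) Λ σ → TM2.Stmt Γ' Λ' σ'
  | .push k f q => .push (ι k) (fun v => f (get v)) (embed ι get set g e q)
  | .peek k f q => .peek (ι k) (fun v s => set (f (get v) s) v) (embed ι get set g e q)
  | .pop k f q => .pop (ι k) (fun v s => set (f (get v) s) v) (embed ι get set g e q)
  | .load f q => .load (fun v => set (f (get v)) v) (embed ι get set g e q)
  | .branch f p q =>
      .branch (fun v => f (get v)) (embed ι get set g e p) (embed ι get set g e q)
  | .goto f => .goto fun v => g (f (get v))
  | .halt => .goto fun _ => e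

variable [DecidableEq K] [DecidableEq K'] {ι : K → K'} {get : σ' → σ} {set : σ → σ' → σ'}
  {g : Λ → Λ'} {e : Λ'}

/-- The configuration `c'` of the larger machine extends the configuration `c` of the subroutine;
outside of the subroutine it has the state of `v` and the stacks of `S`. -/
structure Extends (ι : K → K') (set : σ → σ' → σ') (g : Λ → Λ') (e : Λ') (v : σ')
    (S : ∀ k, List (Γ' k)) (c : TM2.Cfg (fun k => Γ' (ι k)) Λ σ) (c' : TM2.Cfg Γ' Λ' σ') :
    Prop where
  label : c'.l = some (c.l.elim e g)
  var : c'.var = set c.var v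
  stk : ∀ k, c'.stk (ι k) = c.stk k
  other : ∀ k, k ∉ Set.range ι → c'.stk k = S k

/-- `get` and `set` form a lens onto the subroutine's state. The invariant `hw` says that `w`
differs from `v` at most in the part seen through that lens; every statement preserves it. -/
theorem extends_stepAux (hι : Injective ι) (hgs : ∀ s v, get (set s v) = s)
    (hss : ∀ s s' v, set s (set s' v) = set s v)
    (v : σ') (S : ∀ k, List (Γ' k)) (q : TM2.Stmt (fun k => Γ' (ι k)) Λ σ) (w : σ')
    (hw : set (get w) v = w) (U : ∀ k, List (Γ' k)) (hU : ∀ k, k ∉ Set.range ι → U k = S k) :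
    Extends ι set g e v S (TM2.stepAux q (get w) fun k => U (ι k))
      (TM2.stepAux (embed ι get set g e q) w U) := by
  have hupd : ∀ (k : K) (x : List (Γ' (ι k))) (U : ∀ k, List (Γ' k)),
      (fun k' => update U (ι k) x (ι k')) = update (fun k' => U (ι k')) k x := by
    intro k x U
    funext k'
    rcases eq_or_ne k' k with rfl | hk
    · simp
    · rw [update_of_ne hk, update_of_ne (hι.ne hk)]
  have hoth : ∀ (k : K) (x : List (Γ' (ι k))) (U : ∀ k, List (Γ' k)),
      (∀ k, k ∉ Set.range ι → U k = S k) →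
      ∀ k', k' ∉ Set.range ι → update U (ι k) x k' = S k' := by
    intro k x U hU k' hk'
    rw [update_of_ne (fun h => hk' ⟨k, h.symm⟩), hU k' hk']
  have hset : ∀ s (w : σ'), set (get w) v = w → set (get (set s w)) v = set s w := by
    intro s w hw
    rw [hgs, ← hw, hss]
  induction q generalizing w U with
  | push k f q ih =>
    simp only [TM2.stepAux, embed]
    rw [← hupd]
    exact ih w hw _ (hoth _ _ _ hU)
  | peek k f q ih =>
    simp only [TM2.stepAux, embed]
    have := ih (set (f (get w) (U (ι k)).head?) w) (hset _ _ hw) U hU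
    rwa [hgs] at this
  | pop k f q ih =>
    simp only [TM2.stepAux, embed]
    have := ih (set (f (get w) (U (ι k)).head?) w) (hset _ _ hw) _ (hoth k (U (ι k)).tail _ hU)
    rwa [hgs, hupd] at this
  | load f q ih =>
    simp only [TM2.stepAux, embed]
    have := ih (set (f (get w)) w) (hset _ _ hw) U hU
    rwa [hgs] at this
  | branch f p q ihp ihq =>
    simp only [TM2.stepAux, embed]
    cases f (get w)
    · exact ihq w hw U hU
    · exact ihp w hw U hU
  | goto f => exact ⟨rfl, hw.symm, fun _ => rfl, hU⟩
  | halt => exact ⟨rfl, hw.symm, fun _ => rfl, hU⟩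

/-- A terminating run of a subroutine. -/
theorem reach_embed {m : Λ → TM2.Stmt (fun k => Γ' (ι k)) Λ σ} {m' : Λ' → TM2.Stmt Γ' Λ' σ'}
    (hι : Injective ι) (hgs : ∀ s v, get (set s v) = s)
    (hss : ∀ s s' v, set s (set s' v) = set s v) (hsg : ∀ v, set (get v) v = v)
    (hm : ∀ l, m' (g l) = embed ι get set g e (m l))
    {l : Λ} {s : ∀ k, List (Γ' (ι k))} {a b : σ} {s' : ∀ k, List (Γ' (ι k))} {t : ℕ}
    (h : Reach m ⟨some l, a, s⟩ ⟨none, b, s'⟩ t) {v : σ'} {S S' : ∀ k, List (Γ' k)}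
    (hv : get v = a) (hS : ∀ k, S (ι k) = s k) (hS' : ∀ k, S' (ι k) = s' k)
    (hSS' : ∀ k, k ∉ Set.range ι → S' k = S k) :
    Reach m' ⟨some (g l), v, S⟩ ⟨some e, set b v, S'⟩ t := by
  obtain ⟨n, hn, h⟩ := h
  refine ⟨n, hn, ?_⟩
  -- The simulation is step for step. Halting becomes a jump inside the same statement, so even the
  -- last step costs nothing extra.
  have key : ∀ (n : ℕ) (c : TM2.Cfg (fun k => Γ' (ι k)) Λ σ) (c' : TM2.Cfg Γ' Λ' σ'),
      Extends ι set g e v S c c' →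
      (flip bind (TM2.step m))^[n] (some c) = some ⟨none, b, s'⟩ →
      (flip bind (TM2.step m'))^[n] (some c') = some ⟨some e, set b v, S'⟩ := by
    intro n
    induction n with
    | zero =>
      rintro c ⟨l', v', S''⟩ hc h
      cases h
      obtain ⟨h1, h2, h3, h4⟩ := hc
      simp only [Option.elim] at h1 h2 h3 h4
      subst h1 h2
      have : S'' = S' := by
        funext k
        by_cases hk : k ∈ Set.range ι
        · obtain ⟨k, rfl⟩ := hk
          rw [h3, hS']
        · rw [h4 k hk, hSS' k hk]
      subst this
      rfl
    | succ n ih =>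
      -- A configuration that has already halted has no successor, so it cannot begin a run of
      -- positive length.
      rintro ⟨_ | l₁, a₁, s₁⟩ ⟨l', v', S''⟩ hc h
      · rw [iterate_succ_apply] at h
        exact absurd ((iterate_step_none n).symm.trans h) (by simp)
      · rw [iterate_succ_apply] at h ⊢
        obtain ⟨h1, h2, h3, h4⟩ := hc
        simp only [Option.elim] at h1 h2 h3 h4
        subst h1 h2
        refine ih (TM2.stepAux (m l₁) a₁ s₁) (TM2.stepAux (m' (g l₁)) (set a₁ v) S'') ?_ h
        rw [hm]
        have := extends_stepAux (g := g) (e := e) hι hgs hss v S (m l₁) (set a₁ v)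
          (by rw [hgs]) S'' h4
        rw [hgs] at this
        rwa [show (fun k => S'' (ι k)) = s₁ from funext h3] at this
  refine key n _ _ ⟨rfl, ?_, hS, fun _ _ => rfl⟩ h
  rw [← hv, hsg]

end Embed

/-! ### Loops that move the content of a stack -/

section Move

variable {K : Type} [DecidableEq K] {Γ : K → Type} {Λ A τ : Type} [Inhabited A]

/-- The body of the loop at label `l` that moves the content of stack `k` to stack `k'`, and
then jumps to `l'`. -/
def moveStmt (k k' : K) (f : Γ k → A) (g : A → Γ k') (l l' : Λ) :
    TM2.Stmt Γ Λ (Option A × τ) :=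
  .pop k (fun v s => (s.map f, v.2)) <|
    .branch (fun v => v.1.isSome) (.push k' (fun v => g (v.1.getD default)) (.goto fun _ => l))
      (.goto fun _ => l')

/-- Moving letter by letter reverses the content. The loop ends by popping an empty stack, which
resets the register to `none`; later stages and the final configuration depend on this. -/
theorem reach_move {m : Λ → TM2.Stmt Γ Λ (Option A × τ)} {k k' : K} {f : Γ k → A} {g : A → Γ k'}
    {l l' : Λ} (hm : m l = moveStmt k k' f g l l') (hk : k ≠ k') (xs : List (Γ k))
    (v : Option A × τ) (S : ∀ k, List (Γ k)) (hS : S k = xs) :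
    Reach m ⟨some l, v, S⟩
      ⟨some l', (none, v.2), update (update S k []) k' ((xs.map (g ∘ f)).reverse ++ S k')⟩
      (xs.length + 1) := by
  induction xs generalizing v S with
  | nil =>
    apply Reach.step_eq
    simp [hm, moveStmt, hS, update_of_ne hk.symm]
  | cons x xs ih =>
    apply Reach.step
    have h1 : TM2.stepAux (m l) v S =
        ⟨some l, (some (f x), v.2), update (update S k xs) k' (g (f x) :: S k')⟩ := by
      simp [hm, moveStmt, hS, update_of_ne hk.symm]
    rw [h1]
    have := ih (some (f x), v.2) (update (update S k xs) k' (g (f x) :: S k'))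
      (by simp [update_of_ne hk])
    convert this using 2
    · funext j
      rcases eq_or_ne j k' with rfl | hj'
      · simp
      · rcases eq_or_ne j k with rfl | hj <;> simp [update_of_ne, *]
    · simp

end Move

/-! ### Polynomial bounds -/

theorem polynomial_eval_mono (p : Polynomial ℕ) {m n : ℕ} (h : m ≤ n) : p.eval m ≤ p.eval n := by
  rw [Polynomial.eval_eq_sum_range, Polynomial.eval_eq_sum_range]
  exact Finset.sum_le_sum fun i _ => Nat.mul_le_mul_left _ (Nat.pow_le_pow_left h i)

/-- `f` is bounded by a polynomial in `s`. -/
def PolyBounded {α : Type} (s f : α → ℕ) : Prop :=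
  ∃ p : Polynomial ℕ, ∀ a, f a ≤ p.eval (s a)

namespace PolyBounded

variable {α : Type} {s f g : α → ℕ}

theorem mono (hg : PolyBounded s g) (h : ∀ a, f a ≤ g a) : PolyBounded s f :=
  let ⟨p, hp⟩ := hg
  ⟨p, fun a => (h a).trans (hp a)⟩

theorem const (n : ℕ) : PolyBounded s fun _ => n := ⟨Polynomial.C n, fun _ => by simp⟩

theorem self : PolyBounded s s := ⟨Polynomial.X, fun _ => by simp⟩

theorem add (hf : PolyBounded s f) (hg : PolyBounded s g) : PolyBounded s fun a => f a + g a :=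
  let ⟨p, hp⟩ := hf
  let ⟨q, hq⟩ := hg
  ⟨p + q, fun a => by simpa using Nat.add_le_add (hp a) (hq a)⟩

theorem mul (hf : PolyBounded s f) (hg : PolyBounded s g) : PolyBounded s fun a => f a * g a :=
  let ⟨p, hp⟩ := hf
  let ⟨q, hq⟩ := hg
  ⟨p * q, fun a => by simpa using Nat.mul_le_mul (hp a) (hq a)⟩

theorem eval (q : Polynomial ℕ) (hf : PolyBounded s f) :
    PolyBounded s fun a => q.eval (f a) :=
  let ⟨p, hp⟩ := hf
  ⟨q.comp p, fun a => by simpa using polynomial_eval_mono q (hp a)⟩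

theorem trans (hf : PolyBounded s f) (hg : PolyBounded f g) : PolyBounded s g :=
  let ⟨q, hq⟩ := hg
  (hf.eval q).mono hq

theorem comap {β : Type} (hf : PolyBounded s f) (φ : β → α) :
    PolyBounded (fun b => s (φ b)) fun b => f (φ b) :=
  let ⟨p, hp⟩ := hf
  ⟨p, fun b => hp (φ b)⟩

end PolyBounded

/-! ### Machines computing functions -/

theorem initList_eq (tm : FinTM2) (s : List (tm.Γ tm.k₀)) :
    initList tm s = ⟨some tm.main, tm.initialState, update (fun _ => []) tm.k₀ s⟩ := by
  unfold initList
  congr 1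
  funext k
  by_cases h : k = tm.k₀
  · subst h; simp
  · simp [h]

theorem haltList_eq (tm : FinTM2) (s : List (tm.Γ tm.k₁)) :
    haltList tm s = ⟨none, tm.initialState, update (fun _ => []) tm.k₁ s⟩ := by
  unfold haltList
  congr 1
  funext k
  by_cases h : k = tm.k₁
  · subst h; simp
  · simp [h]

/-- The machine `tm` maps `x` to `y` within `t` steps. -/
def Outputs (tm : FinTM2) (x : List (tm.Γ tm.k₀)) (y : List (tm.Γ tm.k₁)) (t : ℕ) : Prop :=
  Reach tm.m ⟨some tm.main, tm.initialState, update (fun _ => []) tm.k₀ x⟩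
    ⟨none, tm.initialState, update (fun _ => []) tm.k₁ y⟩ t

/-! ### Passing between runs and polynomial-time computability -/

section

variable {α β A B : Type} {ea : α → List A} {eb : β → List B} {f : α → β}

theorem computable_of_outputs (tm : FinTM2) (e₀ : tm.Γ tm.k₀ ≃ A) (e₁ : tm.Γ tm.k₁ ≃ B)
    {t : α → ℕ} (ht : PolyBounded (fun a => (ea a).length) t)
    (h : ∀ a, Outputs tm ((ea a).map e₀.symm) ((eb (f a)).map e₁.symm) (t a)) :
    Nonempty (TM2ComputableInPolyTime ea eb f) := by
  obtain ⟨p, hp⟩ := ht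
  refine ⟨⟨⟨tm, e₀, e₁⟩, p, fun a => ?_⟩⟩
  have h' := (h a).mono (hp a)
  refine ⟨⟨h'.choose, ?_⟩, h'.choose_spec.1⟩
  have := h'.choose_spec.2
  rw [initList_eq]
  simp only [Option.map_some]
  rw [haltList_eq]
  exact this

theorem outputs_of_computable (h : TM2ComputableInPolyTime ea eb f) (a : α) :
    Outputs h.tm ((ea a).map h.inputAlphabet.symm) ((eb (f a)).map h.outputAlphabet.symm)
      (h.time.eval (ea a).length) := by
  have := h.outputsFun a
  refine ⟨this.steps, this.steps_le_m, ?_⟩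
  have h2 : (flip bind h.tm.step)^[this.steps] _ = _ := this.evals_in_steps
  generalize this.steps = n at h2
  rw [initList_eq] at h2
  simp only [Option.map_some] at h2
  rw [haltList_eq] at h2
  exact h2

/-- Finitely many labels give a uniform bound `C` on the pushes per step, so a stack grows by at
most `C` times the running time. -/
theorem polyBounded_length_output (h : TM2ComputableInPolyTime ea eb f) :
    PolyBounded (fun a => (ea a).length) fun a => (eb (f a)).length := by
  have := h.tm.ΛFin
  set C := Finset.univ.sup fun l => pushes (h.tm.m l) with hC
  have hC' : ∀ l, pushes (h.tm.m l) ≤ C := fun l =>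
    Finset.le_sup (f := fun l => pushes (h.tm.m l)) (Finset.mem_univ l)
  refine ((PolyBounded.self).add ((PolyBounded.self.eval h.time).mul (.const C))).mono fun a => ?_
  obtain ⟨n, hn, e⟩ := outputs_of_computable h a
  have h1 := length_iterate_le hC' n e h.tm.k₁
  have h2 : (update (fun _ => []) h.tm.k₀ ((ea a).map h.inputAlphabet.symm) h.tm.k₁).length
      ≤ (ea a).length := by
    rcases eq_or_ne h.tm.k₁ h.tm.k₀ with h' | h'
    · rw [h']; simp
    · simp [update_of_ne h']
  simp only [update_self, List.length_map] at h1
  have h3 := Nat.mul_le_mul_right C hn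
  omega

end

/-! ### Machines with two subroutines -/

section Host

variable (M₁ M₂ : FinTM2) (K₀ L : Type)

/-- The alphabets of the stacks of a machine with the subroutines `M₁` and `M₂`. -/
abbrev HostΓ : K₀ ⊕ M₁.K ⊕ M₂.K → Type
  | Sum.inl _ => Bool
  | Sum.inr (Sum.inl k) => M₁.Γ k
  | Sum.inr (Sum.inr k) => M₂.Γ k

/-- The labels of a machine with the subroutines `M₁` and `M₂`. -/
abbrev HostΛ : Type := L ⊕ M₁.Λ ⊕ M₂.Λ

/-- The states of a machine with the subroutines `M₁` and `M₂`. -/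
abbrev HostState : Type := Option Bool × M₁.σ × M₂.σ

/-- The statements of a machine with the subroutines `M₁` and `M₂`. -/
abbrev HostStmt : Type := TM2.Stmt (HostΓ M₁ M₂ K₀) (HostΛ M₁ M₂ L) (HostState M₁ M₂)

variable {M₁ M₂ K₀ L}

/-- The program of a machine with the subroutines `M₁`, which returns to the label `e₁`, and `M₂`,
which returns to `e₂`. -/
def hostProgram (code : L → HostStmt M₁ M₂ K₀ L) (e₁ e₂ : L) :
    HostΛ M₁ M₂ L → HostStmt M₁ M₂ K₀ L
  | Sum.inl l => code l
  | Sum.inr (Sum.inl l) =>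
      embed (Γ' := HostΓ M₁ M₂ K₀) (fun k => Sum.inr (Sum.inl k)) (fun v => v.2.1)
        (fun s v => (v.1, s, v.2.2)) (fun l => Sum.inr (Sum.inl l)) (Sum.inl e₁) (M₁.m l)
  | Sum.inr (Sum.inr l) =>
      embed (Γ' := HostΓ M₁ M₂ K₀) (fun k => Sum.inr (Sum.inr k)) (fun v => v.2.2)
        (fun s v => (v.1, v.2.1, s)) (fun l => Sum.inr (Sum.inr l)) (Sum.inl e₂) (M₂.m l)

/-- The stacks of a machine with the subroutines `M₁` and `M₂`. -/
def hostStacks (s : K₀ → List Bool) (s₁ : ∀ k, List (M₁.Γ k)) (s₂ : ∀ k, List (M₂.Γ k)) :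
    ∀ k, List (HostΓ M₁ M₂ K₀ k)
  | Sum.inl k => s k
  | Sum.inr (Sum.inl k) => s₁ k
  | Sum.inr (Sum.inr k) => s₂ k

variable (s : K₀ → List Bool) (s₁ : ∀ k, List (M₁.Γ k))
  (s₂ : ∀ k, List (M₂.Γ k))

@[simp] theorem hostStacks_inl (k : K₀) : hostStacks s s₁ s₂ (Sum.inl k) = s k := rfl

@[simp] theorem hostStacks_inr_inl (k : M₁.K) : hostStacks s s₁ s₂ (Sum.inr (Sum.inl k)) = s₁ k := rfl

@[simp] theorem hostStacks_inr_inr (k : M₂.K) : hostStacks s s₁ s₂ (Sum.inr (Sum.inr k)) = s₂ k := rfl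

theorem hostStacks_nil : (fun _ => []) = hostStacks (M₁ := M₁) (M₂ := M₂) (K₀ := K₀)
    (fun _ => []) (fun _ => []) (fun _ => []) := by
  funext j
  rcases j with j | j | j <;> rfl

variable [DecidableEq K₀]

@[simp] theorem update_hostStacks_inl (k : K₀) (x : List Bool) :
    update (hostStacks s s₁ s₂) (Sum.inl k) x = hostStacks (update s k x) s₁ s₂ := by
  funext j
  rcases j with j | j | j
  · rcases eq_or_ne j k with rfl | h
    · simp
    · rw [update_of_ne (by simpa using h)]; simp [update_of_ne h]
  · simp
  · simp

@[simp] theorem update_hostStacks_inr_inl (k : M₁.K) (x : List (M₁.Γ k)) :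
    update (hostStacks s s₁ s₂) (Sum.inr (Sum.inl k)) x = hostStacks s (update s₁ k x) s₂ := by
  funext j
  rcases j with j | j | j
  · simp
  · rcases eq_or_ne j k with rfl | h
    · simp
    · rw [update_of_ne (by simpa using h)]; simp [update_of_ne h]
  · simp

@[simp] theorem update_hostStacks_inr_inr (k : M₂.K) (x : List (M₂.Γ k)) :
    update (hostStacks s s₁ s₂) (Sum.inr (Sum.inr k)) x = hostStacks s s₁ (update s₂ k x) := by
  funext j
  rcases j with j | j | j
  · simp
  · simp
  · rcases eq_or_ne j k with rfl | h
    · simp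
    · rw [update_of_ne (by simpa using h)]; simp [update_of_ne h]

variable {s s₁ s₂} {code : L → HostStmt M₁ M₂ K₀ L} {e₁ e₂ : L}

/-- A computing machine starts and stops in its initial state with all stacks but one empty. It
leaves no residue, which is what allows the host to call it again. -/
theorem reach_call₁ {x : List (M₁.Γ M₁.k₀)} {y : List (M₁.Γ M₁.k₁)} {t : ℕ} (h : Outputs M₁ x y t) (r : Option Bool) (v : M₂.σ) :
    Reach (hostProgram code e₁ e₂)
      ⟨some (Sum.inr (Sum.inl M₁.main)), (r, M₁.initialState, v),
        hostStacks s (update (fun _ => []) M₁.k₀ x) s₂⟩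
      ⟨some (Sum.inl e₁), (r, M₁.initialState, v),
        hostStacks s (update (fun _ => []) M₁.k₁ y) s₂⟩ t := by
  refine reach_embed (Γ' := HostΓ M₁ M₂ K₀) (ι := fun k => Sum.inr (Sum.inl k)) (get := fun v => v.2.1)
    (set := fun s v => (v.1, s, v.2.2)) (g := fun l => Sum.inr (Sum.inl l)) (m := M₁.m)
    (S := hostStacks s (update (fun _ => []) M₁.k₀ x) s₂) (S' := hostStacks s (update (fun _ => []) M₁.k₁ y) s₂)
    (fun _ _ h => by simpa using h) (fun _ _ => rfl) (fun _ _ _ => rfl) (fun _ => rfl)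
    (fun _ => rfl) h rfl (fun _ => rfl) (fun _ => rfl) ?_
  rintro (k | k | k) hk
  · rfl
  · exact absurd ⟨k, rfl⟩ hk
  · rfl

theorem reach_call₂ {x : List (M₂.Γ M₂.k₀)} {y : List (M₂.Γ M₂.k₁)} {t : ℕ} (h : Outputs M₂ x y t) (r : Option Bool) (v : M₁.σ) :
    Reach (hostProgram code e₁ e₂)
      ⟨some (Sum.inr (Sum.inr M₂.main)), (r, v, M₂.initialState),
        hostStacks s s₁ (update (fun _ => []) M₂.k₀ x)⟩
      ⟨some (Sum.inl e₂), (r, v, M₂.initialState),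
        hostStacks s s₁ (update (fun _ => []) M₂.k₁ y)⟩ t := by
  refine reach_embed (Γ' := HostΓ M₁ M₂ K₀) (ι := fun k => Sum.inr (Sum.inr k)) (get := fun v => v.2.2)
    (set := fun s v => (v.1, v.2.1, s)) (g := fun l => Sum.inr (Sum.inr l)) (m := M₂.m)
    (S := hostStacks s s₁ (update (fun _ => []) M₂.k₀ x)) (S' := hostStacks s s₁ (update (fun _ => []) M₂.k₁ y))
    (fun _ _ h => by simpa using h) (fun _ _ => rfl) (fun _ _ _ => rfl) (fun _ => rfl)
    (fun _ => rfl) h rfl (fun _ => rfl) (fun _ => rfl) ?_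
  rintro (k | k | k) hk
  · rfl
  · rfl
  · exact absurd ⟨k, rfl⟩ hk

/-- Running the first subroutine on the reversed content of the stack `a`. -/
theorem reach_run₁ {a : K₀} {l : L} {n : HostΛ M₁ M₂ L} (d₀ : M₁.Γ M₁.k₀ ≃ Bool)
    (d₁ : M₁.Γ M₁.k₁ ≃ Bool)
    (hl : code l = moveStmt (Sum.inl a) (Sum.inr (Sum.inl M₁.k₀)) id d₀.symm (Sum.inl l)
      (Sum.inr (Sum.inl M₁.main)))
    (he : code e₁ = moveStmt (Sum.inr (Sum.inl M₁.k₁)) (Sum.inl a) d₁ id (Sum.inl e₁) n)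
    {x y : List Bool} {t : ℕ} (h : Outputs M₁ (x.map d₀.symm) (y.map d₁.symm) t) (hs : s a = x.reverse)
    (r : Option Bool) :
    Reach (hostProgram code e₁ e₂)
      ⟨some (Sum.inl l), (r, M₁.initialState, M₂.initialState),
        hostStacks s (fun _ => []) (fun _ => [])⟩
      ⟨some n, (none, M₁.initialState, M₂.initialState),
        hostStacks (update s a y.reverse) (fun _ => []) (fun _ => [])⟩
      (x.length + 1 + t + (y.length + 1)) := by
  have h1 := reach_move (m := hostProgram code e₁ e₂) (l := Sum.inl l) hl (by simp) x.reverse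
    (r, M₁.initialState, M₂.initialState)
    (hostStacks s (fun _ => []) (fun _ => [])) hs
  have h2 := reach_call₁ (s := update s a []) (s₂ := fun _ => []) (code := code) (e₁ := e₁)
    (e₂ := e₂) h none M₂.initialState
  have h3 := reach_move (m := hostProgram code e₁ e₂) (l := Sum.inl e₁) he (by simp)
    (y.map d₁.symm) (none, M₁.initialState, M₂.initialState)
    (hostStacks (update s a []) (update (fun _ => []) M₁.k₁ (y.map d₁.symm)) (fun _ => []))
    (by simp)
  simp [comp_def] at h1 h2 h3
  exact (h1.trans h2).trans h3

/-- Running the second subroutine on the reversed content of the stack `a`. -/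
theorem reach_run₂ {a : K₀} {l : L} {n : HostΛ M₁ M₂ L} (d₀ : M₂.Γ M₂.k₀ ≃ Bool)
    (d₁ : M₂.Γ M₂.k₁ ≃ Bool)
    (hl : code l = moveStmt (Sum.inl a) (Sum.inr (Sum.inr M₂.k₀)) id d₀.symm (Sum.inl l)
      (Sum.inr (Sum.inr M₂.main)))
    (he : code e₂ = moveStmt (Sum.inr (Sum.inr M₂.k₁)) (Sum.inl a) d₁ id (Sum.inl e₂) n)
    {x y : List Bool} {t : ℕ} (h : Outputs M₂ (x.map d₀.symm) (y.map d₁.symm) t) (hs : s a = x.reverse)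
    (r : Option Bool) :
    Reach (hostProgram code e₁ e₂)
      ⟨some (Sum.inl l), (r, M₁.initialState, M₂.initialState),
        hostStacks s (fun _ => []) (fun _ => [])⟩
      ⟨some n, (none, M₁.initialState, M₂.initialState),
        hostStacks (update s a y.reverse) (fun _ => []) (fun _ => [])⟩
      (x.length + 1 + t + (y.length + 1)) := by
  have h1 := reach_move (m := hostProgram code e₁ e₂) (l := Sum.inl l) hl (by simp) x.reverse
    (r, M₁.initialState, M₂.initialState)
    (hostStacks s (fun _ => []) (fun _ => [])) hs
  have h2 := reach_call₂ (s := update s a []) (s₁ := fun _ => []) (code := code) (e₁ := e₁)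
    (e₂ := e₂) h none M₁.initialState
  have h3 := reach_move (m := hostProgram code e₁ e₂) (l := Sum.inl e₂) he (by simp)
    (y.map d₁.symm) (none, M₁.initialState, M₂.initialState)
    (hostStacks (update s a []) (fun _ => []) (update (fun _ => []) M₂.k₁ (y.map d₁.symm)))
    (by simp)
  simp [comp_def] at h1 h2 h3
  exact (h1.trans h2).trans h3

variable (M₁ M₂) in
/-- A machine with the subroutines `M₁` and `M₂`. -/
def host [Fintype K₀] [Fintype L] (k₀ k₁ : K₀ ⊕ M₁.K ⊕ M₂.K) [Fintype (HostΓ M₁ M₂ K₀ k₀)]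
    (main : HostΛ M₁ M₂ L) (code : L → HostStmt M₁ M₂ K₀ L) (e₁ e₂ : L) : FinTM2 :=
  letI := M₁.kFin
  letI := M₂.kFin
  letI := M₁.ΛFin
  letI := M₂.ΛFin
  letI := M₁.σFin
  letI := M₂.σFin
  { K := K₀ ⊕ M₁.K ⊕ M₂.K
    k₀ := k₀
    k₁ := k₁
    Γ := HostΓ M₁ M₂ K₀
    Λ := HostΛ M₁ M₂ L
    main := main
    σ := HostState M₁ M₂
    initialState := (none, M₁.initialState, M₂.initialState)
    m := hostProgram code e₁ e₂ }

end Host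

section Host

variable {M₁ M₂ : FinTM2} {K₀ L : Type} [DecidableEq K₀] [Fintype K₀] [Fintype L]
  {code : L → HostStmt M₁ M₂ K₀ L} {e₁ e₂ : L}

theorem outputs_host {k₀ k₁ : K₀ ⊕ M₁.K ⊕ M₂.K} [Fintype (HostΓ M₁ M₂ K₀ k₀)]
    {main : HostΛ M₁ M₂ L} {x : List (HostΓ M₁ M₂ K₀ k₀)} {y : List (HostΓ M₁ M₂ K₀ k₁)} {t : ℕ}
    (h : Reach (hostProgram code e₁ e₂)
      ⟨some main, (none, M₁.initialState, M₂.initialState),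
        update (hostStacks (fun _ => []) (fun _ => []) (fun _ => [])) k₀ x⟩
      ⟨none, (none, M₁.initialState, M₂.initialState),
        update (hostStacks (fun _ => []) (fun _ => []) (fun _ => [])) k₁ y⟩ t) :
    Outputs (host M₁ M₂ k₀ k₁ main code e₁ e₂) x y t := by
  rw [← hostStacks_nil] at h
  exact h

theorem computable_of_reach_host {α β : Type} {ea : α → List Bool} {eb : β → List Bool}
    {f : α → β} (k k' : K₀) (main : HostΛ M₁ M₂ L) {t : α → ℕ}
    (ht : PolyBounded (fun a => (ea a).length) t)
    (h : ∀ a, Reach (hostProgram code e₁ e₂)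
      ⟨some main, (none, M₁.initialState, M₂.initialState),
        update (hostStacks (fun _ => []) (fun _ => []) (fun _ => [])) (.inl k) (ea a)⟩
      ⟨none, (none, M₁.initialState, M₂.initialState),
        update (hostStacks (fun _ => []) (fun _ => []) (fun _ => [])) (.inl k') (eb (f a))⟩
      (t a)) :
    Nonempty (TM2ComputableInPolyTime ea eb f) := by
  refine computable_of_outputs (host M₁ M₂ (.inl k) (.inl k') main code e₁ e₂)
    (Equiv.refl Bool) (Equiv.refl Bool) ht fun a => ?_
  -- Recoding by the identity equivalence is only propositionally trivial, so input and output are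
  -- generalized before substituting.
  suffices h' : ∀ x y : List Bool, x = ea a → y = eb (f a) →
      Outputs (host M₁ M₂ (.inl k) (.inl k') main code e₁ e₂) x y (t a) from
    h' _ _ (List.map_id _) (List.map_id _)
  rintro _ _ rfl rfl
  exact outputs_host (h a)

end Host

/-! ### Updating two or three stacks written as a vector -/

section Vec

variable {A : Type} (a b c x : A)

theorem update_vec₂_zero : update ![a, b] 0 x = ![x, b] := by
  funext i; fin_cases i <;> rfl

theorem update_vec₂_one : update ![a, b] 1 x = ![a, x] := by
  funext i; fin_cases i <;> rfl

theorem update_vec₃_zero : update ![a, b, c] 0 x = ![x, b, c] := by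
  funext i; fin_cases i <;> rfl

theorem update_vec₃_one : update ![a, b, c] 1 x = ![a, x, c] := by
  funext i; fin_cases i <;> rfl

theorem update_vec₃_two : update ![a, b, c] 2 x = ![a, b, x] := by
  funext i; fin_cases i <;> rfl

theorem const_eq_vec₂ : (fun _ => a) = ![a, a] := by
  funext i; fin_cases i <;> rfl

theorem const_eq_vec₃ : (fun _ => a) = ![a, a, a] := by
  funext i; fin_cases i <;> rfl

end Vec

/-! ### Composition -/

section Comp

variable (M₁ M₂ : FinTM2) (d₁ : M₁.Γ M₁.k₁ ≃ Bool) (d₂ : M₂.Γ M₂.k₀ ≃ Bool)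

/-- The program that passes the output of the first subroutine to the second one. -/
def compCode : Fin 3 → HostStmt M₁ M₂ Unit (Fin 3)
  | 0 => moveStmt (.inr (.inl M₁.k₁)) (.inl ()) d₁ id (.inl 0) (.inl 1)
  | 1 => moveStmt (.inl ()) (.inr (.inr M₂.k₀)) id d₂.symm (.inl 1) (.inr (.inr M₂.main))
  | 2 => .halt

/-- The intermediate string passes through a Boolean scratch stack; the two moves reverse it twice
and so restore its order. Only the middle encoding has to be Boolean, since the outer strings stay
on the subroutines' own stacks. This freedom serves the tagged pairs in the definition of NP. -/
theorem computable_comp {α β γ A C : Type} {ea : α → List A} {eb : β → List Bool}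
    {ec : γ → List C} {f : α → β} {g : β → γ} (hg : Nonempty (TM2ComputableInPolyTime eb ec g))
    (hf : Nonempty (TM2ComputableInPolyTime ea eb f)) :
    Nonempty (TM2ComputableInPolyTime ea ec fun a => g (f a)) := by
  obtain ⟨hf⟩ := hf
  obtain ⟨hg⟩ := hg
  let _ : Fintype (HostΓ hf.tm hg.tm Unit (.inr (.inl hf.tm.k₀))) := hf.tm.Γk₀Fin
  have pb := polyBounded_length_output hf
  have pt := ((((PolyBounded.self.eval hf.time).add (pb.add (.const 1))).add
    (pb.add (.const 1))).add (pb.eval hg.time)).add (.const 1)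
  refine computable_of_outputs
    (host hf.tm hg.tm (.inr (.inl hf.tm.k₀)) (.inr (.inr hg.tm.k₁)) (.inr (.inl hf.tm.main))
      (compCode hf.tm hg.tm hf.outputAlphabet hg.inputAlphabet) 0 2)
    hf.inputAlphabet hg.outputAlphabet pt fun a => ?_
  suffices h : Reach
      (hostProgram (compCode hf.tm hg.tm hf.outputAlphabet hg.inputAlphabet) 0 2)
      ⟨some (.inr (.inl hf.tm.main)), (none, hf.tm.initialState, hg.tm.initialState),
        update (hostStacks (fun _ => []) (fun _ => []) (fun _ => [])) (.inr (.inl hf.tm.k₀))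
          ((ea a).map hf.inputAlphabet.symm)⟩
      ⟨none, (none, hf.tm.initialState, hg.tm.initialState),
        update (hostStacks (fun _ => []) (fun _ => []) (fun _ => [])) (.inr (.inr hg.tm.k₁))
          ((ec (g (f a))).map hg.outputAlphabet.symm)⟩ _ from outputs_host h
  have h1 := reach_call₁ (s := fun _ => []) (s₂ := fun _ => []) (K₀ := Unit) (e₁ := 0) (e₂ := 2)
    (code := compCode hf.tm hg.tm hf.outputAlphabet hg.inputAlphabet)
    (outputs_of_computable hf a) none hg.tm.initialState
  have h2 := reach_move
    (m := hostProgram (compCode hf.tm hg.tm hf.outputAlphabet hg.inputAlphabet) 0 2)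
    (l := .inl 0) rfl (by simp) ((eb (f a)).map hf.outputAlphabet.symm)
    (none, hf.tm.initialState, hg.tm.initialState)
    (hostStacks (fun _ => [])
      (update (fun _ => []) hf.tm.k₁ ((eb (f a)).map hf.outputAlphabet.symm)) (fun _ => []))
    (by simp)
  have h3 := reach_move
    (m := hostProgram (compCode hf.tm hg.tm hf.outputAlphabet hg.inputAlphabet) 0 2)
    (l := .inl 1) rfl (by simp) (eb (f a)).reverse
    (none, hf.tm.initialState, hg.tm.initialState)
    (hostStacks (fun _ => (eb (f a)).reverse) (fun _ => []) (fun _ => []))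
    (by simp)
  have h4 := reach_call₂ (s := fun _ => []) (s₁ := fun _ => []) (K₀ := Unit) (e₁ := 0) (e₂ := 2)
    (code := compCode hf.tm hg.tm hf.outputAlphabet hg.inputAlphabet)
    (outputs_of_computable hg (f a)) none hf.tm.initialState
  have h5 : Reach
      (hostProgram (compCode hf.tm hg.tm hf.outputAlphabet hg.inputAlphabet) 0 2)
      ⟨some (.inl 2), (none, hf.tm.initialState, hg.tm.initialState), hostStacks (fun _ => [])
        (fun _ => []) (update (fun _ => []) hg.tm.k₁ ((ec (g (f a))).map hg.outputAlphabet.symm))⟩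
      ⟨none, (none, hf.tm.initialState, hg.tm.initialState), hostStacks (fun _ => [])
        (fun _ => []) (update (fun _ => []) hg.tm.k₁ ((ec (g (f a))).map hg.outputAlphabet.symm))⟩
      1 := Reach.step_eq rfl
  simp [comp_def] at h2 h3
  rw [show (update (fun _ => []) () (eb (f a)).reverse : Unit → List Bool)
    = fun _ => (eb (f a)).reverse from by funext; simp] at h2
  rw [show (update (fun _ => (eb (f a)).reverse) () [] : Unit → List Bool)
    = fun _ => [] from by funext; simp] at h3
  simp only [update_hostStacks_inr_inl, update_hostStacks_inr_inr]
  have := (((h1.trans h2).trans h3).trans h4).trans h5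
  simpa [comp_def] using this

end Comp

/-! ### Encodings -/

/-- Every letter of the string is preceded by `true`. -/
def double (l : List Bool) : List Bool := l.flatMap fun b => [true, b]

@[simp] theorem double_nil : double [] = [] := rfl

@[simp] theorem double_cons (b : Bool) (l : List Bool) :
    double (b :: l) = true :: b :: double l := rfl

@[simp] theorem length_double (l : List Bool) : (double l).length = 2 * l.length := by
  induction l with
  | nil => rfl
  | cons b l ih => simp [ih]; ring

/-- Types whose elements are represented by strings. -/
class Rep (α : Type) where
  /-- The string representing an element. -/
  enc : α → List Bool

open PublicGoods.Rep (enc)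

/-- The length of the representation. -/
def size {α : Type} [Rep α] (a : α) : ℕ := (enc a).length

/-- The encodings of bits, numbers and strings are those of the statement, so `PolyTime` unfolds to
`PolyTimeFun` and `PolyTimePattern` on the relevant types. -/
instance : Rep Bool := ⟨Computability.encodeBool⟩

instance : Rep ℕ := ⟨Computability.unaryEncodeNat⟩

instance : Rep (List Bool) := ⟨id⟩

/-- Self-delimiting: `true` announces another letter of the first component and `false` ends it, so
a stack program can split the pair while popping. Only the first component doubles in length. -/
instance {α β : Type} [Rep α] [Rep β] : Rep (α × β) :=
  ⟨fun p => double (enc p.1) ++ false :: enc p.2⟩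

theorem unaryEncodeNat_eq (n : ℕ) : Computability.unaryEncodeNat n = List.replicate n true := by
  induction n with
  | zero => rfl
  | succ n ih => simp [Computability.unaryEncodeNat, ih, List.replicate_succ]

theorem enc_bool (b : Bool) : enc b = [b] := rfl

theorem enc_nat (n : ℕ) : enc n = List.replicate n true := unaryEncodeNat_eq n

theorem enc_list (l : List Bool) : enc l = l := rfl

theorem enc_prod {α β : Type} [Rep α] [Rep β] (p : α × β) :
    enc p = double (enc p.1) ++ false :: enc p.2 := rfl

@[simp] theorem size_bool (b : Bool) : size b = 1 := rfl

@[simp] theorem size_nat (n : ℕ) : size n = n := by simp [size, enc_nat]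

@[simp] theorem size_list (l : List Bool) : size l = l.length := rfl

@[simp] theorem size_prod {α β : Type} [Rep α] [Rep β] (p : α × β) :
    size p = 2 * size p.1 + 1 + size p.2 := by
  simp [size, enc_prod]; ring

/-- `f` is computable in polynomial time. -/
@[fun_prop]
def PolyTime {α β : Type} [Rep α] [Rep β] (f : α → β) : Prop :=
  Nonempty (TM2ComputableInPolyTime (enc (α := α)) (enc (α := β)) f)

section

variable {α β γ : Type} [Rep α] [Rep β] [Rep γ]

theorem PolyTime.polyBounded {f : α → β} (h : PolyTime f) :
    PolyBounded (size (α := α)) fun a => size (f a) :=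
  let ⟨h⟩ := h
  polyBounded_length_output h

@[fun_prop]
theorem PolyTime.comp {g : β → γ} {f : α → β} (hg : PolyTime g) (hf : PolyTime f) :
    PolyTime fun a => g (f a) :=
  computable_comp hg hf

@[fun_prop]
theorem PolyTime.id : PolyTime fun a : α => a := ⟨idComputableInPolyTime _⟩

end

/-! ### Pairing -/

section Pair

variable (M₁ M₂ : FinTM2) (d₁ : M₁.Γ M₁.k₀ ≃ Bool) (d₁' : M₁.Γ M₁.k₁ ≃ Bool)
  (d₂ : M₂.Γ M₂.k₀ ≃ Bool) (d₂' : M₂.Γ M₂.k₁ ≃ Bool)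

/-- The program that runs both subroutines on the input and pairs the outputs. -/
def pairCode : Fin 8 → HostStmt M₁ M₂ (Fin 3) (Fin 8)
  | 0 => .pop (.inl 0) (fun v s => (s, v.2)) <| .branch (fun v => v.1.isSome)
      (.push (.inl 1) (fun v => v.1.getD false) <| .push (.inl 2) (fun v => v.1.getD false) <|
        .goto fun _ => .inl 0)
      (.goto fun _ => .inl 1)
  | 1 => moveStmt (.inl 1) (.inr (.inl M₁.k₀)) id d₁.symm (.inl 1) (.inr (.inl M₁.main))
  | 2 => moveStmt (.inr (.inl M₁.k₁)) (.inl 1) d₁' id (.inl 2) (.inl 3)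
  | 3 => moveStmt (.inl 2) (.inr (.inr M₂.k₀)) id d₂.symm (.inl 3) (.inr (.inr M₂.main))
  | 4 => moveStmt (.inr (.inr M₂.k₁)) (.inl 2) d₂' id (.inl 4) (.inl 5)
  | 5 => moveStmt (.inl 2) (.inl 0) id id (.inl 5) (.inl 6)
  | 6 => .push (.inl 0) (fun _ => false) <| .goto fun _ => .inl 7
  | 7 => .pop (.inl 1) (fun v s => (s, v.2)) <| .branch (fun v => v.1.isSome)
      (.push (.inl 0) (fun v => v.1.getD false) <| .push (.inl 0) (fun _ => true) <|
        .goto fun _ => .inl 7)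
      .halt

variable {M₁ M₂ d₁ d₁' d₂ d₂'}

theorem pairCode_reach₀ (w : M₁.σ × M₂.σ) (xs a b : List Bool) (r : Option Bool) :
    Reach (hostProgram (pairCode M₁ M₂ d₁ d₁' d₂ d₂') 2 4)
      ⟨some (.inl 0), (r, w), hostStacks ![xs, a, b] (fun _ => []) (fun _ => [])⟩
      ⟨some (.inl 1), (none, w), hostStacks ![[], xs.reverse ++ a, xs.reverse ++ b]
        (fun _ => []) (fun _ => [])⟩ (xs.length + 1) := by
  induction xs generalizing a b r with
  | nil =>
    apply Reach.step_eq
    simp [hostProgram, pairCode, update_vec₃_zero]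
  | cons x xs ih =>
    apply Reach.step
    simpa [hostProgram, pairCode, update_vec₃_zero, update_vec₃_one, update_vec₃_two] using
      ih (x :: a) (x :: b) (some x)

theorem pairCode_reach₇ (w : M₁.σ × M₂.σ) (xs a : List Bool) (r : Option Bool) :
    Reach (hostProgram (pairCode M₁ M₂ d₁ d₁' d₂ d₂') 2 4)
      ⟨some (.inl 7), (r, w), hostStacks ![a, xs, []] (fun _ => []) (fun _ => [])⟩
      ⟨none, (none, w), hostStacks ![double xs.reverse ++ a, [], []]
        (fun _ => []) (fun _ => [])⟩ (xs.length + 1) := by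
  induction xs generalizing a r with
  | nil =>
    apply Reach.step_eq
    simp [hostProgram, pairCode, update_vec₃_one]
  | cons x xs ih =>
    apply Reach.step
    simpa [hostProgram, pairCode, update_vec₃_zero, update_vec₃_one, double] using
      ih (true :: x :: a) (some x)

theorem pairCode_reach {x y z : List Bool} {t₁ t₂ : ℕ}
    (h₁ : Outputs M₁ (x.map d₁.symm) (y.map d₁'.symm) t₁)
    (h₂ : Outputs M₂ (x.map d₂.symm) (z.map d₂'.symm) t₂) :
    Reach (hostProgram (pairCode M₁ M₂ d₁ d₁' d₂ d₂') 2 4)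
      ⟨some (.inl 0), (none, M₁.initialState, M₂.initialState),
        update (hostStacks (fun _ => []) (fun _ => []) (fun _ => [])) (.inl 0) x⟩
      ⟨none, (none, M₁.initialState, M₂.initialState),
        update (hostStacks (fun _ => []) (fun _ => []) (fun _ => [])) (.inl 0)
          (double y ++ false :: z)⟩
      (x.length + 1 + (x.length + 1 + t₁ + (y.length + 1)) +
        (x.length + 1 + t₂ + (z.length + 1)) + (z.length + 1) + 1 + (y.length + 1)) := by
  have s0 := pairCode_reach₀ (d₁ := d₁) (d₁' := d₁') (d₂ := d₂) (d₂' := d₂')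
    (M₁.initialState, M₂.initialState) x [] [] none
  have s1 := reach_run₁ (code := pairCode M₁ M₂ d₁ d₁' d₂ d₂') (e₁ := 2) (e₂ := 4) (a := 1)
    (l := 1) d₁ d₁' rfl rfl h₁ (s := ![[], x.reverse, x.reverse]) rfl none
  have s3 := reach_run₂ (code := pairCode M₁ M₂ d₁ d₁' d₂ d₂') (e₁ := 2) (e₂ := 4) (a := 2)
    (l := 3) d₂ d₂' rfl rfl h₂ (s := ![[], y.reverse, x.reverse]) rfl none
  have s5 := reach_move (m := hostProgram (pairCode M₁ M₂ d₁ d₁' d₂ d₂') 2 4) (l := .inl 5)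
    rfl (by simp) z.reverse (none, M₁.initialState, M₂.initialState)
    (hostStacks ![[], y.reverse, z.reverse] (fun _ => []) (fun _ => [])) rfl
  have s6 : Reach (hostProgram (pairCode M₁ M₂ d₁ d₁' d₂ d₂') 2 4)
      ⟨some (.inl 6), (none, M₁.initialState, M₂.initialState),
        hostStacks ![z, y.reverse, []] (fun _ => []) (fun _ => [])⟩
      ⟨some (.inl 7), (none, M₁.initialState, M₂.initialState),
        hostStacks ![false :: z, y.reverse, []] (fun _ => []) (fun _ => [])⟩ 1 := by
    apply Reach.step_eq
    simp [hostProgram, pairCode, update_vec₃_zero]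
  have s7 := pairCode_reach₇ (d₁ := d₁) (d₁' := d₁') (d₂ := d₂) (d₂' := d₂')
    (M₁.initialState, M₂.initialState) y.reverse (false :: z) none
  simp [update_vec₃_zero, update_vec₃_one, update_vec₃_two] at s0 s1 s3 s5 s7
  simp only [update_hostStacks_inl]
  rw [const_eq_vec₃, update_vec₃_zero, update_vec₃_zero]
  exact ((((s0.trans s1).trans s3).trans s5).trans s6).trans s7

-- A subroutine consumes its input, so the input is first copied onto two stacks. The result is
-- written from the back: second component, delimiter, then the doubled first component.
@[fun_prop]
theorem PolyTime.prodMk {α β γ : Type} [Rep α] [Rep β] [Rep γ] {f : α → β} {g : α → γ}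
    (hf : PolyTime f) (hg : PolyTime g) : PolyTime fun a => (f a, g a) := by
  have bf := hf.polyBounded
  have bg := hg.polyBounded
  obtain ⟨hf⟩ := hf
  obtain ⟨hg⟩ := hg
  have b := PolyBounded.self (s := size (α := α))
  have c := PolyBounded.const (s := size (α := α)) 1
  exact computable_of_reach_host 0 0 (.inl 0)
    ((((((b.add c).add (((b.add c).add (b.eval hf.time)).add (bf.add c))).add
      (((b.add c).add (b.eval hg.time)).add (bg.add c))).add (bg.add c)).add c).add
      (bf.add c)) fun a =>
    pairCode_reach (outputs_of_computable hf a) (outputs_of_computable hg a)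

end Pair

/-! ### Case distinction -/

section Cond

variable (M₁ M₂ : FinTM2) (d₁ : M₁.Γ M₁.k₀ ≃ Bool) (d₁' : M₁.Γ M₁.k₁ ≃ Bool)
  (d₂ : M₂.Γ M₂.k₀ ≃ Bool) (d₂' : M₂.Γ M₂.k₁ ≃ Bool)

/-- The program that runs the first or the second subroutine on the second component of the input,
depending on the first component. -/
def condCode : Fin 9 → HostStmt M₁ M₂ (Fin 2) (Fin 9)
  | 0 => .pop (.inl 0) (fun v _ => v) <| .pop (.inl 0) (fun v s => (s, v.2)) <|
      .pop (.inl 0) (fun v _ => v) <| .branch (fun v => v.1.getD false)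
      (.goto fun _ => .inl 1) (.goto fun _ => .inl 2)
  | 1 => moveStmt (.inl 0) (.inl 1) id id (.inl 1) (.inl 3)
  | 2 => moveStmt (.inl 0) (.inl 1) id id (.inl 2) (.inl 5)
  | 3 => moveStmt (.inl 1) (.inr (.inl M₁.k₀)) id d₁.symm (.inl 3) (.inr (.inl M₁.main))
  | 4 => moveStmt (.inr (.inl M₁.k₁)) (.inl 1) d₁' id (.inl 4) (.inl 7)
  | 5 => moveStmt (.inl 1) (.inr (.inr M₂.k₀)) id d₂.symm (.inl 5) (.inr (.inr M₂.main))
  | 6 => moveStmt (.inr (.inr M₂.k₁)) (.inl 1) d₂' id (.inl 6) (.inl 7)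
  | 7 => moveStmt (.inl 1) (.inl 0) id id (.inl 7) (.inl 8)
  | 8 => .halt

variable {M₁ M₂ d₁ d₁' d₂ d₂'}

/-- Only the selected branch has to compute `y`. Charging `t₁ + t₂` in both cases keeps the time
bound free of a case distinction. -/
theorem condCode_reach {b : Bool} {x y : List Bool} {t₁ t₂ : ℕ}
    (h₁ : b = true → Outputs M₁ (x.map d₁.symm) (y.map d₁'.symm) t₁)
    (h₂ : b = false → Outputs M₂ (x.map d₂.symm) (y.map d₂'.symm) t₂) :
    Reach (hostProgram (condCode M₁ M₂ d₁ d₁' d₂ d₂') 4 6)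
      ⟨some (.inl 0), (none, M₁.initialState, M₂.initialState),
        update (hostStacks (fun _ => []) (fun _ => []) (fun _ => [])) (.inl 0)
          (true :: b :: false :: x)⟩
      ⟨none, (none, M₁.initialState, M₂.initialState),
        update (hostStacks (fun _ => []) (fun _ => []) (fun _ => [])) (.inl 0) y⟩
      (1 + (x.length + 1) + (x.length + 1 + (t₁ + t₂) + (y.length + 1)) + (y.length + 1) + 1) := by
  have s0 : Reach (hostProgram (condCode M₁ M₂ d₁ d₁' d₂ d₂') 4 6)
      ⟨some (.inl 0), (none, M₁.initialState, M₂.initialState),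
        hostStacks ![true :: b :: false :: x, []] (fun _ => []) (fun _ => [])⟩
      ⟨some (.inl (cond b 1 2)), (some b, M₁.initialState, M₂.initialState),
        hostStacks ![x, []] (fun _ => []) (fun _ => [])⟩ 1 := by
    apply Reach.step_eq
    cases b <;> simp [hostProgram, condCode, update_vec₂_zero]
  have s1 : Reach (hostProgram (condCode M₁ M₂ d₁ d₁' d₂ d₂') 4 6)
      ⟨some (.inl (cond b 1 2)), (some b, M₁.initialState, M₂.initialState),
        hostStacks ![x, []] (fun _ => []) (fun _ => [])⟩
      ⟨some (.inl (cond b 3 5)), (none, M₁.initialState, M₂.initialState),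
        hostStacks ![[], x.reverse] (fun _ => []) (fun _ => [])⟩ (x.length + 1) := by
    cases b
    · have := reach_move (m := hostProgram (condCode M₁ M₂ d₁ d₁' d₂ d₂') 4 6) (l := .inl 2)
        rfl (by simp) x (some false, M₁.initialState, M₂.initialState)
        (hostStacks ![x, []] (fun _ => []) (fun _ => [])) rfl
      simpa [update_vec₂_zero, update_vec₂_one] using this
    · have := reach_move (m := hostProgram (condCode M₁ M₂ d₁ d₁' d₂ d₂') 4 6) (l := .inl 1)
        rfl (by simp) x (some true, M₁.initialState, M₂.initialState)
        (hostStacks ![x, []] (fun _ => []) (fun _ => [])) rfl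
      simpa [update_vec₂_zero, update_vec₂_one] using this
  have s3 : Reach (hostProgram (condCode M₁ M₂ d₁ d₁' d₂ d₂') 4 6)
      ⟨some (.inl (cond b 3 5)), (none, M₁.initialState, M₂.initialState),
        hostStacks ![[], x.reverse] (fun _ => []) (fun _ => [])⟩
      ⟨some (.inl 7), (none, M₁.initialState, M₂.initialState),
        hostStacks ![[], y.reverse] (fun _ => []) (fun _ => [])⟩
      (x.length + 1 + (t₁ + t₂) + (y.length + 1)) := by
    cases b
    · have := reach_run₂ (code := condCode M₁ M₂ d₁ d₁' d₂ d₂') (e₁ := 4) (e₂ := 6) (a := 1)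
        (l := 5) d₂ d₂' rfl rfl (h₂ rfl) (s := ![[], x.reverse]) rfl none
      rw [update_vec₂_one] at this
      exact this.mono (by omega)
    · have := reach_run₁ (code := condCode M₁ M₂ d₁ d₁' d₂ d₂') (e₁ := 4) (e₂ := 6) (a := 1)
        (l := 3) d₁ d₁' rfl rfl (h₁ rfl) (s := ![[], x.reverse]) rfl none
      rw [update_vec₂_one] at this
      exact this.mono (by omega)
  have s7 := reach_move (m := hostProgram (condCode M₁ M₂ d₁ d₁' d₂ d₂') 4 6) (l := .inl 7)
    rfl (by simp) y.reverse (none, M₁.initialState, M₂.initialState)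
    (hostStacks ![[], y.reverse] (fun _ => []) (fun _ => [])) rfl
  have s8 : Reach (hostProgram (condCode M₁ M₂ d₁ d₁' d₂ d₂') 4 6)
      ⟨some (.inl 8), (none, M₁.initialState, M₂.initialState),
        hostStacks ![y, []] (fun _ => []) (fun _ => [])⟩
      ⟨none, (none, M₁.initialState, M₂.initialState),
        hostStacks ![y, []] (fun _ => []) (fun _ => [])⟩ 1 := Reach.step_eq rfl
  simp [update_vec₂_zero, update_vec₂_one] at s7
  simp only [update_hostStacks_inl]
  rw [const_eq_vec₂, update_vec₂_zero, update_vec₂_zero]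
  exact (((s0.trans s1).trans s3).trans s7).trans s8

@[fun_prop]
theorem PolyTime.cond {α β : Type} [Rep α] [Rep β] {c : α → Bool} {f g : α → β}
    (hc : PolyTime c) (hf : PolyTime f) (hg : PolyTime g) :
    PolyTime fun a => bif c a then f a else g a := by
  -- The condition is evaluated beforehand and paired with the input, so the machine only inspects
  -- the three letters that precede the second component.
  suffices h : PolyTime fun p : Bool × α => bif p.1 then f p.2 else g p.2 from
    h.comp (hc.prodMk .id)
  have bf := hf.polyBounded
  have bg := hg.polyBounded
  obtain ⟨hf⟩ := hf
  obtain ⟨hg⟩ := hg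
  have b : PolyBounded (size (α := Bool × α)) fun p => size p.2 :=
    PolyBounded.self.mono fun p => by simp
  have c := PolyBounded.const (s := size (α := Bool × α)) 1
  have b' := b.trans ((bf.comap Prod.snd).add (bg.comap Prod.snd))
  have b'' : PolyBounded (size (α := Bool × α)) fun p =>
      size (bif p.1 then f p.2 else g p.2) := b'.mono fun p => by
    cases p.1 <;> simp
  exact computable_of_reach_host 0 0 (.inl 0)
    ((((c.add (b.add c)).add (((b.add c).add ((b.eval hf.time).add (b.eval hg.time))).add
      (b''.add c))).add (b''.add c)).add c) fun p =>
    condCode_reach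
      (fun h => by rw [h]; exact outputs_of_computable hf p.2)
      (fun h => by rw [h]; exact outputs_of_computable hg p.2)

end Cond

/-! ### Iteration -/

section Iterate

variable (M : FinTM2) (d : M.Γ M.k₀ ≃ Bool) (d' : M.Γ M.k₁ ≃ Bool)

/-- The program that applies a subroutine to the second component of the input as often as the
first component says. -/
def iterateCode : Fin 7 → HostStmt M (idComputer Bool) (Fin 3) (Fin 7)
  | 0 => .pop (.inl 0) (fun v s => (s, v.2)) <| .branch (fun v => v.1.getD false)
      (.pop (.inl 0) (fun v _ => v) <| .push (.inl 2) (fun _ => true) <| .goto fun _ => .inl 0)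
      (.goto fun _ => .inl 1)
  | 1 => moveStmt (.inl 0) (.inl 1) id id (.inl 1) (.inl 2)
  | 2 => .pop (.inl 2) (fun v s => (s, v.2)) <| .branch (fun v => v.1.isSome)
      (.goto fun _ => .inl 3) (.goto fun _ => .inl 5)
  | 3 => moveStmt (.inl 1) (.inr (.inl M.k₀)) id d.symm (.inl 3) (.inr (.inl M.main))
  | 4 => moveStmt (.inr (.inl M.k₁)) (.inl 1) d' id (.inl 4) (.inl 2)
  | 5 => moveStmt (.inl 1) (.inl 0) id id (.inl 5) (.inl 6)
  | 6 => .halt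

variable {M d d'}

/-- The unary counter is unpacked onto its own stack. The host expects two subroutines; the second
is a dummy that is never called. -/
theorem iterateCode_reach₀ (w : M.σ × (idComputer Bool).σ) (k : ℕ) (x c : List Bool)
    (r : Option Bool) :
    Reach (hostProgram (iterateCode M d d') 4 6)
      ⟨some (.inl 0), (r, w), hostStacks ![double (List.replicate k true) ++ false :: x, [], c]
        (fun _ => []) (fun _ => [])⟩
      ⟨some (.inl 1), (some false, w), hostStacks ![x, [], List.replicate k true ++ c]
        (fun _ => []) (fun _ => [])⟩ (k + 1) := by
  induction k generalizing c r with
  | zero =>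
    apply Reach.step_eq
    simp [hostProgram, iterateCode, update_vec₃_zero]
  | succ k ih =>
    apply Reach.step
    have hr : List.replicate k true ++ true :: c = true :: (List.replicate k true ++ c) := by
      rw [← List.singleton_append, ← List.append_assoc, ← List.replicate_succ',
        List.replicate_succ, List.cons_append]
    simpa [hostProgram, iterateCode, update_vec₃_zero, update_vec₃_two, List.replicate_succ,
      hr] using ih (true :: c) (some true)

theorem iterateCode_reach₂ {β : Type} {eb : β → List Bool} {step : β → β} {q : ℕ → ℕ}
    (hq : Monotone q)
    (h : ∀ b, Outputs M ((eb b).map d.symm) ((eb (step b)).map d'.symm) (q (eb b).length))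
    (k B : ℕ) (b : β) (hB : ∀ i ≤ k, (eb (step^[i] b)).length ≤ B) :
    Reach (hostProgram (iterateCode M d d') 4 6)
      ⟨some (.inl 2), (none, M.initialState, (idComputer Bool).initialState),
        hostStacks ![[], (eb b).reverse, List.replicate k true] (fun _ => []) (fun _ => [])⟩
      ⟨some (.inl 5), (none, M.initialState, (idComputer Bool).initialState),
        hostStacks ![[], (eb (step^[k] b)).reverse, []] (fun _ => []) (fun _ => [])⟩
      (k * (1 + (B + 1 + q B + (B + 1))) + 1) := by
  induction k generalizing b with
  | zero =>
    exact (Reach.step_eq (by simp [hostProgram, iterateCode, update_vec₃_two])).mono (by omega)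
  | succ k ih =>
    have s2 : Reach (hostProgram (iterateCode M d d') 4 6)
      ⟨some (.inl 2), (none, M.initialState, (idComputer Bool).initialState),
        hostStacks ![[], (eb b).reverse, List.replicate (k + 1) true] (fun _ => []) (fun _ => [])⟩
      ⟨some (.inl 3), (some true, M.initialState, (idComputer Bool).initialState),
        hostStacks ![[], (eb b).reverse, List.replicate k true] (fun _ => []) (fun _ => [])⟩ 1 := by
      apply Reach.step_eq
      simp [hostProgram, iterateCode, update_vec₃_two, List.replicate_succ]
    have s3 := reach_run₁ (code := iterateCode M d d') (e₁ := 4) (e₂ := 6) (a := 1)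
      (l := 3) d d' rfl rfl (h b) (s := ![[], (eb b).reverse, List.replicate k true]) rfl
      (some true)
    rw [update_vec₃_one] at s3
    refine ((s2.trans s3).trans (ih (step b) fun i hi => hB (i + 1) (by omega))).mono ?_
    have h0 := hB 0 (by omega)
    have h1 := hB 1 (by omega)
    have h2 := hq h0
    simp only [iterate_zero, iterate_one, id_eq] at h0 h1 h2
    rw [Nat.add_one_mul]
    omega

/-- The bound `B` on all intermediate results is essential: a polynomial-time step may double its
argument, and iteration would then give exponential size. -/
theorem computable_iterate {α β : Type} {eb : β → List Bool} {n : α → ℕ} {init : α → β}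
    {step : β → β} (h : Nonempty (TM2ComputableInPolyTime eb eb step)) {B : α → ℕ}
    (hB : PolyBounded
      (fun a => (double (List.replicate (n a) true) ++ false :: eb (init a)).length) B)
    (hB' : ∀ a, ∀ i ≤ n a, (eb (step^[i] (init a))).length ≤ B a) :
    Nonempty (TM2ComputableInPolyTime
      (fun a => double (List.replicate (n a) true) ++ false :: eb (init a)) eb
      fun a => step^[n a] (init a)) := by
  obtain ⟨h⟩ := h
  set s := fun a => (double (List.replicate (n a) true) ++ false :: eb (init a)).length with hs
  have bn : PolyBounded s n := PolyBounded.self.mono fun a => by simp [hs]; omega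
  have bi : PolyBounded s fun a => (eb (init a)).length :=
    PolyBounded.self.mono fun a => by simp [hs]; omega
  have c := PolyBounded.const (s := s) 1
  refine computable_of_reach_host (code := iterateCode h.tm h.inputAlphabet h.outputAlphabet)
    (e₁ := 4) (e₂ := 6) 0 0 (.inl 0)
    (((((bn.add c).add (bi.add c)).add ((bn.mul (c.add (((hB.add c).add (hB.eval h.time)).add
      (hB.add c)))).add c)).add (hB.add c)).add c) fun a => ?_
  have s0 := iterateCode_reach₀ (d := h.inputAlphabet) (d' := h.outputAlphabet)
    (h.tm.initialState, (idComputer Bool).initialState) (n a) (eb (init a)) [] none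
  have s1 := reach_move
    (m := hostProgram (iterateCode h.tm h.inputAlphabet h.outputAlphabet) 4 6) (l := .inl 1)
    rfl (by simp) (eb (init a)) (some false, h.tm.initialState, (idComputer Bool).initialState)
    (hostStacks ![eb (init a), [], List.replicate (n a) true] (fun _ => []) (fun _ => [])) rfl
  have s2 := iterateCode_reach₂ (q := fun n => h.time.eval n)
    (fun _ _ => polynomial_eval_mono h.time) (outputs_of_computable h) (n a) (B a) (init a) (hB' a)
  have s5 := (reach_move
    (m := hostProgram (iterateCode h.tm h.inputAlphabet h.outputAlphabet) 4 6) (l := .inl 5)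
    rfl (by simp) (eb (step^[n a] (init a))).reverse
    (none, h.tm.initialState, (idComputer Bool).initialState)
    (hostStacks ![[], (eb (step^[n a] (init a))).reverse, []] (fun _ => []) (fun _ => []))
    rfl).mono (t' := B a + 1) (by simpa using hB' a _ le_rfl)
  have s6 : Reach (hostProgram (iterateCode h.tm h.inputAlphabet h.outputAlphabet) 4 6)
      ⟨some (.inl 6), (none, h.tm.initialState, (idComputer Bool).initialState),
        hostStacks ![eb (step^[n a] (init a)), [], []] (fun _ => []) (fun _ => [])⟩
      ⟨none, (none, h.tm.initialState, (idComputer Bool).initialState),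
        hostStacks ![eb (step^[n a] (init a)), [], []] (fun _ => []) (fun _ => [])⟩ 1 :=
    Reach.step_eq rfl
  simp [update_vec₃_zero, update_vec₃_one] at s0 s1 s5
  simp only [update_hostStacks_inl]
  rw [const_eq_vec₃, update_vec₃_zero, update_vec₃_zero]
  exact (((s0.trans s1).trans s2).trans s5).trans s6

end Iterate

/-! ### Basic functions -/

/-- A machine sees only strings, so the output may be reinterpreted in any type in which it has the
same code. -/
theorem computable_congr {α β β' A B : Type} {ea : α → List A} {eb : β → List B}
    {eb' : β' → List B} {f : α → β} {f' : α → β'} (h : Nonempty (TM2ComputableInPolyTime ea eb f))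
    (hf : ∀ a, eb (f a) = eb' (f' a)) : Nonempty (TM2ComputableInPolyTime ea eb' f') :=
  let ⟨h⟩ := h
  ⟨⟨h.toTM2ComputableAux, h.time, fun a => hf a ▸ h.outputsFun a⟩⟩

theorem PolyTime.congr {α β : Type} [Rep α] [Rep β] {f f' : α → β} (h : PolyTime f)
    (hf : ∀ a, f a = f' a) : PolyTime f' :=
  funext hf ▸ h

theorem PolyTime.of_enc_eq {α β : Type} [Rep α] [Rep β] {f : α → β}
    (h : ∀ a, enc (f a) = enc a) : PolyTime f :=
  computable_congr PolyTime.id fun a => (h a).symm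

section Basic

/-- Programs without subroutines. -/
abbrev BasicStmt (n : ℕ) : Type :=
  HostStmt (idComputer Bool) (idComputer Bool) (Fin 2) (Fin n)

theorem computable_of_reach {α β : Type} {ea : α → List Bool} {eb : β → List Bool}
    {f : α → β} {n : ℕ} {code : Fin (n + 1) → BasicStmt (n + 1)} (k : Fin 2) {t : α → ℕ}
    (ht : PolyBounded (fun a => (ea a).length) t)
    (h : ∀ a, Reach (hostProgram code 0 0)
      ⟨some (.inl 0), (none, (), ()), hostStacks ![ea a, []] (fun _ => []) (fun _ => [])⟩
      ⟨none, (none, (), ()), hostStacks (update ![[], []] k (eb (f a))) (fun _ => [])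
        (fun _ => [])⟩ (t a)) :
    Nonempty (TM2ComputableInPolyTime ea eb f) := by
  refine computable_of_reach_host (code := code) (e₁ := 0) (e₂ := 0) 0 k (.inl 0) ht fun a => ?_
  have := h a
  simp only [update_hostStacks_inl]
  rw [const_eq_vec₂, update_vec₂_zero]
  exact this

/-- The program for the second component. -/
def sndCode : Fin 1 → BasicStmt 1
  | _ => .pop (.inl 0) (fun v s => (s, v.2)) <| .branch (fun v => v.1.getD false)
      (.pop (.inl 0) (fun v _ => v) <| .goto fun _ => .inl 0)
      (.load (fun v => (none, v.2)) .halt)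

/-- The program for the first component. -/
def fstCode : Fin 4 → BasicStmt 4
  | 0 => .pop (.inl 0) (fun v s => (s, v.2)) <| .branch (fun v => v.1.getD false)
      (.pop (.inl 0) (fun v s => (s, v.2)) <| .push (.inl 1) (fun v => v.1.getD false) <|
        .goto fun _ => .inl 0)
      (.goto fun _ => .inl 1)
  | 1 => .pop (.inl 0) (fun v s => (s, v.2)) <| .branch (fun v => v.1.isSome)
      (.goto fun _ => .inl 1) (.goto fun _ => .inl 2)
  | 2 => moveStmt (.inl 1) (.inl 0) id id (.inl 2) (.inl 3)
  | 3 => .halt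

/-- The program for functions that depend only on the first letter. -/
def headCode (q : Option Bool → Bool) : Fin 2 → BasicStmt 2
  | 0 => .pop (.inl 0) (fun v s => (s, v.2)) <| .push (.inl 1) (fun v => q v.1) <|
      .goto fun _ => .inl 1
  | 1 => .pop (.inl 0) (fun v s => (s, v.2)) <| .branch (fun v => v.1.isSome)
      (.goto fun _ => .inl 1) .halt

/-- The program that reverses a string and applies `g` to its letters. -/
def revMapCode (g : Bool → Bool) : Fin 2 → BasicStmt 2
  | 0 => moveStmt (.inl 0) (.inl 1) id g (.inl 0) (.inl 1)
  | 1 => .halt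

variable {α β : Type} [Rep α] [Rep β]

@[fun_prop]
theorem PolyTime.snd : PolyTime (Prod.snd : α × β → β) := by
  have b := PolyBounded.self (s := fun p : α × β => (enc p).length)
  refine computable_of_reach (code := sndCode) 0 (b.add (.const 1)) fun p => ?_
  have s0 : ∀ (x y : List Bool) (r : Option Bool), Reach (hostProgram sndCode 0 0)
      ⟨some (.inl 0), (r, (), ()), hostStacks ![double x ++ false :: y, []] (fun _ => [])
        (fun _ => [])⟩
      ⟨none, (none, (), ()), hostStacks ![y, []] (fun _ => []) (fun _ => [])⟩
      (x.length + 1) := by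
    intro x y r
    induction x generalizing r with
    | nil =>
      apply Reach.step_eq
      simp [hostProgram, sndCode, update_vec₂_zero]
    | cons c x ih =>
      apply Reach.step
      simpa [hostProgram, sndCode, update_vec₂_zero] using ih (some true)
  rw [enc_prod, update_vec₂_zero]
  exact (s0 _ _ _).mono (by simp; omega)

@[fun_prop]
theorem PolyTime.fst : PolyTime (Prod.fst : α × β → α) := by
  have b := PolyBounded.self (s := fun p : α × β => (enc p).length)
  have c := PolyBounded.const (s := fun p : α × β => (enc p).length) 1
  refine computable_of_reach (code := fstCode) 0 ((((b.add c).add (b.add c)).add (b.add c)).add c)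
    fun p => ?_
  have s0 : ∀ (x y a : List Bool) (r : Option Bool), Reach (hostProgram fstCode 0 0)
      ⟨some (.inl 0), (r, (), ()), hostStacks ![double x ++ false :: y, a] (fun _ => [])
        (fun _ => [])⟩
      ⟨some (.inl 1), (some false, (), ()), hostStacks ![y, x.reverse ++ a] (fun _ => [])
        (fun _ => [])⟩ (x.length + 1) := by
    intro x y a r
    induction x generalizing a r with
    | nil =>
      apply Reach.step_eq
      simp [hostProgram, fstCode, update_vec₂_zero]
    | cons c x ih =>
      apply Reach.step
      simpa [hostProgram, fstCode, update_vec₂_zero, update_vec₂_one] using ih (c :: a) (some c)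
  have s1 : ∀ (y a : List Bool) (r : Option Bool), Reach (hostProgram fstCode 0 0)
      ⟨some (.inl 1), (r, (), ()), hostStacks ![y, a] (fun _ => []) (fun _ => [])⟩
      ⟨some (.inl 2), (none, (), ()), hostStacks ![[], a] (fun _ => [])
        (fun _ => [])⟩ (y.length + 1) := by
    intro y a r
    induction y generalizing r with
    | nil =>
      apply Reach.step_eq
      simp [hostProgram, fstCode, update_vec₂_zero]
    | cons c x ih =>
      apply Reach.step
      simpa [hostProgram, fstCode, update_vec₂_zero, update_vec₂_one] using ih (some c)
  have s2 := reach_move (m := hostProgram fstCode 0 0) (l := .inl 2) rfl (by simp)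
    (enc p.1).reverse (none, (), ()) (hostStacks ![[], (enc p.1).reverse] (fun _ => [])
      (fun _ => [])) rfl
  have s3 : Reach (hostProgram fstCode 0 0)
      ⟨some (.inl 3), (none, (), ()), hostStacks ![enc p.1, []] (fun _ => []) (fun _ => [])⟩
      ⟨none, (none, (), ()), hostStacks ![enc p.1, []] (fun _ => []) (fun _ => [])⟩ 1 :=
    Reach.step_eq rfl
  simp [update_vec₂_zero, update_vec₂_one] at s2
  rw [enc_prod, update_vec₂_zero]
  have s0' := s0 (enc p.1) (enc p.2) [] none
  rw [List.append_nil] at s0'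
  refine (((s0'.trans (s1 _ _ _)).trans s2).trans s3).mono ?_
  simp; omega

theorem PolyTime.head (q : Option Bool → Bool) : PolyTime fun l : List Bool => q l.head? := by
  have b := PolyBounded.self (s := fun l : List Bool => (enc l).length)
  refine computable_of_reach (code := headCode q) 1 ((b.add (.const 1)).add (.const 1))
    fun l => ?_
  rw [enc_list, enc_bool, update_vec₂_one]
  have s1 : ∀ (y a : List Bool) (r : Option Bool), Reach (hostProgram (headCode q) 0 0)
      ⟨some (.inl 1), (r, (), ()), hostStacks ![y, a] (fun _ => []) (fun _ => [])⟩
      ⟨none, (none, (), ()), hostStacks ![[], a] (fun _ => []) (fun _ => [])⟩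
      (y.length + 1) := by
    intro y a r
    induction y generalizing r with
    | nil =>
      apply Reach.step_eq
      simp [hostProgram, headCode, update_vec₂_zero]
    | cons c x ih =>
      apply Reach.step
      simpa [hostProgram, headCode, update_vec₂_zero, update_vec₂_one] using ih (some c)
  refine Reach.step ?_
  -- The first step has consumed the head; the rest of the input must still be erased before
  -- halting.
  have := (s1 l.tail [q l.head?] l.head?).mono (t' := l.length + 1) (by simp)
  simpa [hostProgram, headCode, update_vec₂_zero, update_vec₂_one] using this

theorem PolyTime.revMap (g : Bool → Bool) :
    PolyTime fun l : List Bool => (l.map g).reverse := by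
  have b := PolyBounded.self (s := fun l : List Bool => (enc l).length)
  refine computable_of_reach (code := revMapCode g) 1 ((b.add (.const 1)).add (.const 1))
    fun l => ?_
  have s0 := reach_move (m := hostProgram (revMapCode g) 0 0) (l := .inl 0) rfl (by simp)
    l (none, (), ()) (hostStacks ![l, []] (fun _ => []) (fun _ => [])) rfl
  simp [update_vec₂_zero, update_vec₂_one] at s0
  rw [enc_list, enc_list, update_vec₂_one]
  exact s0.trans (Reach.step_eq rfl)

theorem PolyTime.cons_const (c : Bool) : PolyTime fun l : List Bool => c :: l :=
  computable_of_reach (n := 0) (code := fun _ => .push (.inl 0) (fun _ => c) .halt) 0 (.const 1)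
    fun l => Reach.step_eq (by simp [hostProgram, update_vec₂_zero, enc_list])

theorem PolyTime.list_tail : PolyTime fun l : List Bool => l.tail :=
  computable_of_reach (n := 0) (code := fun _ => .pop (.inl 0) (fun v _ => v) .halt) 0 (.const 1)
    fun l => Reach.step_eq (by simp [hostProgram, update_vec₂_zero, enc_list])

end Basic

theorem iterate_prod {α β : Type} (step : α → β → β) (a : α) (b : β) (i : ℕ) :
    (fun p : α × β => (p.1, step p.1 p.2))^[i] (a, b) = (a, (step a)^[i] b) := by
  induction i generalizing b with
  | zero => rfl
  | succ i ih => rw [iterate_succ_apply, ih, iterate_succ_apply]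

/-- Iterating a step function, provided that the intermediate results have polynomial size. -/
theorem PolyTime.iterate {α β : Type} [Rep α] [Rep β] {n : α → ℕ} {init : α → β}
    {step : α → β → β} (hn : PolyTime n) (hi : PolyTime init)
    (hs : PolyTime fun p : α × β => step p.1 p.2) {B : α → ℕ} (hB : PolyBounded size B)
    (hB' : ∀ a, ∀ i ≤ n a, size ((step a)^[i] (init a)) ≤ B a) :
    PolyTime fun a => (step a)^[n a] (init a) := by
  -- The parameter `a` is carried along in the iterated state, which accounts for the extra `2 *
  -- size a + 1`.
  have h1 := computable_iterate (n := n) (init := fun a => (a, init a))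
    (PolyTime.fst.prodMk hs) (B := fun a => 2 * size a + 1 + B a) (by
      have h : PolyBounded (fun a => (double (List.replicate (n a) true) ++
          false :: enc (a, init a)).length) size :=
        PolyBounded.self.mono fun a => by
          have := size_prod (a, init a)
          simp [size] at this ⊢
          omega
      exact h.trans ((((PolyBounded.const 2).mul .self).add (.const 1)).add hB))
    (fun a i hi => by
      rw [iterate_prod]
      have := size_prod (a, (step a)^[i] (init a))
      have := hB' a i hi
      simp only [size] at *
      omega)
  have h2 : PolyTime fun a => (n a, a, init a) := hn.prodMk (PolyTime.id.prodMk hi)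
  have h3 := computable_comp h1 (computable_congr (f' := fun a : α => a) h2 fun a => by
    rw [enc_prod, enc_nat])
  refine computable_congr (computable_comp PolyTime.snd h3) fun a => ?_
  rw [iterate_prod]

/-! ### Strings and numbers -/

section Derived

variable {α β : Type} [Rep α] [Rep β]

@[fun_prop]
theorem PolyTime.const (b : β) : PolyTime fun _ : α => b := by
  have h : ∀ l : List Bool, PolyTime fun _ : α => l := by
    intro l
    induction l with
    | nil =>
      have h0 : PolyTime fun a : α => enc a :=
        computable_congr (f := fun a : α => a) PolyTime.id fun _ => rfl
      -- The empty string: `head` turns any input into a single letter, and `tail` removes that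
      -- letter.
      exact PolyTime.list_tail.comp (computable_congr (eb' := fun l : List Bool => l)
        (f' := fun _ => [true]) ((PolyTime.head fun _ => true).comp h0) fun _ => rfl)
    | cons c l ih => exact (PolyTime.cons_const c).comp ih
  exact computable_congr (h (enc b)) fun _ => rfl

variable {f g : α → Bool} {l l' : α → List Bool} {m n : α → ℕ}

@[fun_prop]
theorem PolyTime.not (hf : PolyTime f) : PolyTime fun a => !f a :=
  (hf.cond (.const false) (.const true)).congr fun a => by cases f a <;> rfl

@[fun_prop]
theorem PolyTime.and (hf : PolyTime f) (hg : PolyTime g) : PolyTime fun a => f a && g a :=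
  (hf.cond hg (.const false)).congr fun a => by cases f a <;> rfl

@[fun_prop]
theorem PolyTime.beq_bool (hf : PolyTime f) (hg : PolyTime g) : PolyTime fun a => f a == g a :=
  (hf.cond hg hg.not).congr fun a => by cases f a <;> cases g a <;> rfl

@[fun_prop]
theorem PolyTime.cons (hf : PolyTime f) (hl : PolyTime l) : PolyTime fun a => f a :: l a :=
  (hf.cond ((PolyTime.cons_const true).comp hl) ((PolyTime.cons_const false).comp hl)).congr
    fun a => by cases f a <;> rfl

@[fun_prop]
theorem PolyTime.tail (hl : PolyTime l) : PolyTime fun a => (l a).tail :=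
  PolyTime.list_tail.comp hl

@[fun_prop]
theorem PolyTime.headD (hl : PolyTime l) (d : Bool) : PolyTime fun a => (l a).headD d :=
  ((PolyTime.head fun o => o.getD d).comp hl).congr fun _ => List.headD_eq_head?_getD.symm

@[fun_prop]
theorem PolyTime.isEmpty (hl : PolyTime l) : PolyTime fun a => (l a).isEmpty :=
  ((PolyTime.head fun o => o.isNone).comp hl).congr fun a => by cases l a <;> rfl

@[fun_prop]
theorem PolyTime.reverse (hl : PolyTime l) : PolyTime fun a => (l a).reverse :=
  ((PolyTime.revMap fun b => b).comp hl).congr fun a => by simp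

-- Replacing every letter by `true` yields the unary code of the length.
@[fun_prop]
theorem PolyTime.length (hl : PolyTime l) : PolyTime fun a => (l a).length := by
  refine PolyTime.comp (g := List.length) ?_ hl
  refine computable_congr (PolyTime.revMap fun _ => true) fun l => ?_
  rw [enc_list, enc_nat]
  simp

@[fun_prop]
theorem PolyTime.replicate_true (hn : PolyTime n) :
    PolyTime fun a => List.replicate (n a) true :=
  (PolyTime.of_enc_eq (f := fun n : ℕ => List.replicate n true) fun n => (enc_nat n).symm).comp hn

@[fun_prop]
theorem PolyTime.succ (hn : PolyTime n) : PolyTime fun a => n a + 1 :=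
  (show PolyTime fun a => (true :: List.replicate (n a) true).length by fun_prop).congr
    fun a => by simp

@[fun_prop]
theorem PolyTime.drop (hn : PolyTime n) (hl : PolyTime l) :
    PolyTime fun a => (l a).drop (n a) := by
  refine (PolyTime.iterate (step := fun _ l => l.tail) hn hl (by fun_prop) hl.polyBounded
    fun a i _ => ?_).congr fun a => ?_
  · induction i with
    | zero => simp
    | succ i ih => rw [iterate_succ_apply']; exact (by simp : _ ≤ _).trans (ih (by omega))
  · induction n a with
    | zero => rfl
    | succ k ih => rw [iterate_succ_apply', ih, List.tail_drop]

@[fun_prop]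
theorem PolyTime.getD (hl : PolyTime l) (hn : PolyTime n) (d : Bool) :
    PolyTime fun a => (l a).getD (n a) d :=
  (show PolyTime fun a => ((l a).drop (n a)).headD d by fun_prop).congr fun a => by
    simp [List.headD_eq_head?_getD]

@[fun_prop]
theorem PolyTime.append (hl : PolyTime l) (hl' : PolyTime l') :
    PolyTime fun a => l a ++ l' a := by
  -- The letters of the reversed first string are moved one at a time onto the second. Beyond
  -- `x.length` moves the default of `headD` would add spurious letters, hence the bound on `i`.
  have key : ∀ (i : ℕ) (x y : List Bool), i ≤ x.length →
      (fun p : List Bool × List Bool => (p.1.tail, p.1.headD false :: p.2))^[i] (x.reverse, y)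
        = ((x.take (x.length - i)).reverse, x.drop (x.length - i) ++ y) := by
    intro i x y hi
    have h : ∀ (u v y : List Bool),
        (fun p : List Bool × List Bool => (p.1.tail, p.1.headD false :: p.2))^[v.length]
          ((u ++ v).reverse, y) = (u.reverse, v ++ y) := by
      intro u v
      induction v using List.reverseRecOn with
      | nil => simp
      | append_singleton v b ih =>
        intro y
        rw [List.length_append, ← List.append_assoc, List.reverse_append]
        simpa using ih (b :: y)
    have h' := h (x.take (x.length - i)) (x.drop (x.length - i)) y
    rw [List.take_append_drop, List.length_drop, Nat.sub_sub_self hi] at h'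
    exact h'
  have h := PolyTime.iterate (α := α) (β := List Bool × List Bool)
    (n := fun a => (l a).length) (init := fun a => ((l a).reverse, l' a))
    (step := fun _ p => (p.1.tail, p.1.headD false :: p.2)) (by fun_prop) (by fun_prop)
    (by fun_prop)
    ((((PolyBounded.const 2).mul hl.polyBounded).add (.const 1)).add
      (hl.polyBounded.add hl'.polyBounded)) fun a i hi => by
      rw [key i _ _ hi]
      simp
      omega
  refine (PolyTime.snd.comp h).congr fun a => ?_
  rw [key _ _ _ le_rfl]
  simp

theorem PolyTime.flatMap_range {g : α → ℕ → List Bool} (hn : PolyTime n)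
    (hg : PolyTime fun p : α × ℕ => g p.1 p.2) :
    PolyTime fun a => (List.range (n a)).flatMap (g a) := by
  have key : ∀ (a : α) (i : ℕ),
      (fun p : ℕ × List Bool => (p.1 + 1, p.2 ++ g a p.1))^[i] (0, [])
        = (i, (List.range i).flatMap (g a)) := by
    intro a i
    induction i with
    | zero => rfl
    | succ i ih => rw [iterate_succ_apply', ih, List.range_succ, List.flatMap_append]; simp
  obtain ⟨q, hq⟩ := hg.polyBounded
  -- The bound is taken at a common `k`, so that one value of the polynomial `q` covers all blocks.
  have hlen : ∀ (a : α) (i k : ℕ), i ≤ k → ((List.range i).flatMap (g a)).length ≤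
      i * q.eval (2 * size a + 1 + k) := by
    intro a i k hi
    induction i with
    | zero => simp
    | succ i ih =>
      have h1 := (hq (a, i)).trans (polynomial_eval_mono q
        (by simp; omega : size (a, i) ≤ 2 * size a + 1 + k))
      rw [List.range_succ, List.flatMap_append, List.length_append, Nat.add_one_mul]
      simp only [size_list] at h1
      simpa using Nat.add_le_add (ih (by omega)) h1
  have hg' : PolyTime fun p : α × ℕ × List Bool => g p.1 p.2.1 :=
    hg.comp (f := fun p : α × ℕ × List Bool => (p.1, p.2.1)) (by fun_prop)
  have hb := hn.polyBounded
  simp only [size_nat] at hb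
  have h := PolyTime.iterate (β := ℕ × List Bool) (init := fun _ => (0, []))
    (step := fun a p => (p.1 + 1, p.2 ++ g a p.1)) hn (by fun_prop) (by fun_prop)
    ((((PolyBounded.const 2).mul hb).add (.const 1)).add (hb.mul
      (((((PolyBounded.const 2).mul .self).add (.const 1)).add hb).eval q))) fun a i hi => by
      rw [key, size_prod]
      have h1 := hlen a i (n a) hi
      have h2 := Nat.mul_le_mul_right (q.eval (2 * size a + 1 + n a)) hi
      simp only [size_nat, size_list]
      omega
  exact (PolyTime.snd.comp h).congr fun a => by rw [key]

theorem PolyTime.countP_range {p : α → ℕ → Bool} (hn : PolyTime n)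
    (hp : PolyTime fun q : α × ℕ => p q.1 q.2) :
    PolyTime fun a => (List.range (n a)).countP (p a) := by
  have h := PolyTime.flatMap_range (g := fun a i => bif p a i then [true] else []) hn
    (by fun_prop)
  refine h.length.congr fun a => ?_
  induction List.range (n a) with
  | nil => rfl
  | cons i l ih =>
    rw [List.flatMap_cons, List.length_append, ih, List.countP_cons]
    cases p a i <;> simp [Nat.add_comm]

theorem PolyTime.all_range {p : α → ℕ → Bool} (hn : PolyTime n)
    (hp : PolyTime fun q : α × ℕ => p q.1 q.2) :
    PolyTime fun a => (List.range (n a)).all (p a) := by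
  have h := PolyTime.countP_range (p := fun a i => !p a i) hn (by fun_prop)
  refine h.replicate_true.isEmpty.congr fun a => ?_
  rw [Bool.eq_iff_iff]
  simp [List.countP_eq_zero]

theorem PolyTime.any_range {p : α → ℕ → Bool} (hn : PolyTime n)
    (hp : PolyTime fun q : α × ℕ => p q.1 q.2) :
    PolyTime fun a => (List.range (n a)).any (p a) :=
  (PolyTime.all_range (p := fun a i => !p a i) hn (by fun_prop)).not.congr fun a => by
    rw [Bool.eq_iff_iff]
    simp

@[fun_prop]
theorem PolyTime.add (hm : PolyTime m) (hn : PolyTime n) : PolyTime fun a => m a + n a :=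
  (show PolyTime fun a => (List.replicate (m a) true ++ List.replicate (n a) true).length by
    fun_prop).congr fun a => by simp

@[fun_prop]
theorem PolyTime.sub (hm : PolyTime m) (hn : PolyTime n) : PolyTime fun a => m a - n a :=
  (show PolyTime fun a => ((List.replicate (m a) true).drop (n a)).length by
    fun_prop).congr fun a => by simp

@[fun_prop]
theorem PolyTime.mul (hm : PolyTime m) (hn : PolyTime n) : PolyTime fun a => m a * n a :=
  (PolyTime.flatMap_range (g := fun a _ => List.replicate (n a) true) hm
    (by fun_prop)).length.congr fun a => by simp

-- Two numbers are equal iff both truncated differences vanish, and a number is zero iff its unary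
-- string is empty.
@[fun_prop]
theorem PolyTime.beq_nat (hm : PolyTime m) (hn : PolyTime n) : PolyTime fun a => m a == n a :=
  (show PolyTime fun a => (List.replicate ((m a - n a) + (n a - m a)) true).isEmpty by
    fun_prop).congr fun a => by
      rw [Bool.eq_iff_iff]
      simp
      omega

end Derived

/-! ### Pairs of strings over a tagged alphabet -/

section Tagged

/-- The alphabets of the machine that translates tagged pairs. -/
abbrev TagΓ : Bool ⊕ Unit → Type
  | .inl _ => Bool ⊕ Bool
  | .inr _ => Bool

/-- The program that translates tagged pairs. -/
def tagCode : Fin 3 → TM2.Stmt TagΓ (Fin 3) (Option (Bool ⊕ Bool) × Unit)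
  | 0 => moveStmt (.inl false) (.inl true) id id 0 1
  | 1 => .pop (.inl true) (fun v s => (s, v.2)) <|
      .branch (fun v => (v.1.bind Sum.getRight?).isSome)
        (.push (.inr ()) (fun v => (v.1.bind Sum.getRight?).getD false) <| .goto fun _ => 1)
        (.push (.inr ()) (fun _ => false) <|
          .branch (fun v => v.1.isSome)
            (.push (.inr ()) (fun v => (v.1.bind Sum.getLeft?).getD false) <|
              .push (.inr ()) (fun _ => true) <| .goto fun _ => 2)
            .halt)
  | 2 => .pop (.inl true) (fun v s => (s, v.2)) <|
      .branch (fun v => v.1.isSome)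
        (.push (.inr ()) (fun v => (v.1.bind Sum.getLeft?).getD false) <|
          .push (.inr ()) (fun _ => true) <| .goto fun _ => 2)
        .halt

/-- The machine that translates tagged pairs. -/
def tagMachine : FinTM2 where
  K := Bool ⊕ Unit
  k₀ := .inl false
  k₁ := .inr ()
  Γ := TagΓ
  Λ := Fin 3
  main := 0
  σ := Option (Bool ⊕ Bool) × Unit
  initialState := (none, ())
  Γk₀Fin := inferInstanceAs (Fintype (Bool ⊕ Bool))
  m := tagCode

/-- The stacks of the machine that translates tagged pairs. -/
def tagStacks (a b : List (Bool ⊕ Bool)) (c : List Bool) : ∀ k, List (TagΓ k)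
  | .inl false => a
  | .inl true => b
  | .inr _ => c

variable (a b a' b' : List (Bool ⊕ Bool)) (c c' : List Bool)

@[simp] theorem update_tagStacks₀ :
    update (tagStacks a b c) (.inl false) a' = tagStacks a' b c := by
  funext k
  rcases k with (_ | _) | _ <;> simp [tagStacks, update]

@[simp] theorem update_tagStacks₁ :
    update (tagStacks a b c) (.inl true) b' = tagStacks a b' c := by
  funext k
  rcases k with (_ | _) | _ <;> simp [tagStacks, update]

@[simp] theorem update_tagStacks₂ :
    update (tagStacks a b c) (.inr ()) c' = tagStacks a b c' := by
  funext k
  rcases k with (_ | _) | _ <;> simp [tagStacks, update]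

theorem tagStacks_nil : (fun _ => []) = tagStacks [] [] [] := by
  funext k
  rcases k with (_ | _) | _ <;> rfl

theorem tagCode_reach₂ (x : List Bool) (c : List Bool) (r : Option (Bool ⊕ Bool)) :
    Reach tagCode ⟨some 2, (r, ()), tagStacks [] (x.map Sum.inl).reverse c⟩
      ⟨none, (none, ()), tagStacks [] [] (double x ++ c)⟩ (x.length + 1) := by
  induction x using List.reverseRecOn generalizing c r with
  | nil =>
    apply Reach.step_eq
    simp [tagCode, tagStacks]
  | append_singleton x b ih =>
    have := ih (true :: b :: c) (some (.inl b))
    rw [List.length_append]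
    apply Reach.step
    simpa [tagCode, tagStacks, double] using this

/-- Reading goes from the back. The first pop without a right-tagged letter, be it a left-tagged one
or an empty stack, is where the delimiter `false` is written; a left-tagged letter met there is
copied in the same step. -/
theorem tagCode_reach₁ (x y : List Bool) (c : List Bool) (r : Option (Bool ⊕ Bool)) :
    Reach tagCode
      ⟨some 1, (r, ()), tagStacks [] (x.map Sum.inl ++ y.map Sum.inr).reverse c⟩
      ⟨none, (none, ()), tagStacks [] [] (double x ++ false :: (y ++ c))⟩
      (x.length + 1 + y.length + 1) := by
  induction y using List.reverseRecOn generalizing c r with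
  | nil =>
    apply Reach.step
    induction x using List.reverseRecOn with
    | nil => exact (by simpa [tagCode, tagStacks] using Reach.refl _ : Reach _ _ _ 0).mono (by simp)
    | append_singleton x b _ =>
      have := tagCode_reach₂ x (true :: b :: false :: c) (some (.inl b))
      exact (by simpa [tagCode, tagStacks, double] using this : Reach _ _ _ (x.length + 1)).mono
        (by simp)
  | append_singleton y b ih =>
    have := ih (b :: c) (some (.inr b))
    rw [List.length_append]
    apply Reach.step
    simpa [tagCode, tagStacks, ← Nat.add_assoc] using this

theorem computable_tagged :
    Nonempty (TM2ComputableInPolyTime encodePair (enc (α := List Bool × List Bool)) fun p => p) := by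
  have b := PolyBounded.self (s := fun p => (encodePair p).length)
  refine computable_of_outputs tagMachine (Equiv.refl (Bool ⊕ Bool)) (Equiv.refl Bool)
    ((b.add (.const 1)).add (b.add (.const 2))) fun p => ?_
  suffices h : ∀ x y, x = encodePair p → y = enc p → Outputs tagMachine x y
      ((encodePair p).length + 1 + ((encodePair p).length + 2)) from
    h _ _ (List.map_id _) (List.map_id _)
  rintro _ _ rfl rfl
  suffices h : Reach tagCode
      ⟨some 0, (none, ()), update (tagStacks [] [] []) (.inl false) (encodePair p)⟩
      ⟨none, (none, ()), update (tagStacks [] [] []) (.inr ()) (enc p)⟩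
      ((encodePair p).length + 1 + ((encodePair p).length + 2)) by
    rw [← tagStacks_nil] at h
    exact h
  have s0 := reach_move (m := tagCode) (l := 0) (l' := 1) (k := .inl false) (k' := .inl true)
    (f := id) (g := id) rfl (by simp) (encodePair p) (none, ())
    (tagStacks (encodePair p) [] []) rfl
  have s1 := tagCode_reach₁ p.1 p.2 [] none
  simp [tagStacks] at s0
  simp only [update_tagStacks₀, update_tagStacks₂]
  have := s0.trans s1
  rw [List.append_nil] at this
  refine this.mono ?_
  simp [encodePair]
  omega

theorem polyTimeVerifier_of_polyTime {V : List Bool × List Bool → Bool} (h : PolyTime V) :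
    PolyTimeVerifier V :=
  computable_comp h computable_tagged

end Tagged

/-! ### Gadgets -/

/-- The number of producing neighbours of `g` in the graph with adjacency `H` under `b`. -/
def gadgetCount (H : Fin 7 → Fin 7 → Bool) (b : Fin 7 → Bool) (g : Fin 7) : ℕ :=
  ∑ g', (H g g' && b g').toNat

/-- A graph on seven vertices that, when all vertices except `0` play best responses, always has
exactly two producing neighbours of `0`, and allows both strategies of `0`. -/
structure IsGadget (T : Pattern) (H : Fin 7 → Fin 7 → Bool) : Prop where
  symm : ∀ g g', H g g' = H g' g
  irrefl : ∀ g, H g g = false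
  count_zero : ∀ b : Fin 7 → Bool, (∀ g, g ≠ 0 → b g = T (gadgetCount H b g)) →
    gadgetCount H b 0 = 2
  exists_response : ∀ c : Bool, ∃ b : Fin 7 → Bool, b 0 = c ∧
    ∀ g, g ≠ 0 → b g = T (gadgetCount H b g)

/-- The adjacency given by the rows of an adjacency matrix. -/
def tableAdj (tab : List Bool) (g g' : ℕ) : Bool := tab.getD (7 * g + g') false

/-- The gadget for patterns that start with `1, 0, 1, 0`. -/
def tableZero : List Bool :=
  [false, true, true, true, true, false, false,
   true, false, false, false, false, true, false,
   true, false, false, false, false, true, false,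
   true, false, false, false, false, false, true,
   true, false, false, false, false, false, true,
   false, true, true, false, false, false, true,
   false, false, false, true, true, true, false]

/-- The gadget for patterns that start with `1, 0, 1, 1`. -/
def tableOne : List Bool :=
  [false, true, true, false, false, false, false,
   true, false, true, true, false, true, true,
   true, true, false, true, false, false, false,
   false, true, true, false, true, false, false,
   false, false, false, true, false, false, false,
   false, true, false, false, false, false, false,
   false, true, false, false, false, false, false]

variable {T : Pattern}

/-- On counts up to 3 the pattern tests for evenness. Vertices 1 and 2 are twins adjacent to 0 and
5, and 3 and 4 are twins adjacent to 0 and 6. Twins contribute evenly, so the adjacent vertices 5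
and 6 must play opposite strategies. Exactly one of them agrees with 0, and exactly the
corresponding pair of twins produces. -/
theorem isGadget_tableZero (h0 : T 0 = true) (h1 : T 1 = false) (h2 : T 2 = true)
    (h3 : T 3 = false) : IsGadget T fun g g' => tableAdj tableZero g g' where
  symm := by decide
  irrefl := by decide
  count_zero b hb := by
    have e1 := hb 1 (by decide)
    have e2 := hb 2 (by decide)
    have e3 := hb 3 (by decide)
    have e4 := hb 4 (by decide)
    have e5 := hb 5 (by decide)
    have e6 := hb 6 (by decide)
    simp only [gadgetCount, Fin.sum_univ_seven] at e1 e2 e3 e4 e5 e6 ⊢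
    simp [tableAdj, tableZero] at e1 e2 e3 e4 e5 e6 ⊢
    generalize b 0 = b0 at *
    generalize b 1 = b1 at *
    generalize b 2 = b2 at *
    generalize b 3 = b3 at *
    generalize b 4 = b4 at *
    generalize b 5 = b5 at *
    generalize b 6 = b6 at *
    clear hb
    revert e1 e2 e3 e4 e5 e6
    cases b0 <;> cases b1 <;> cases b2 <;> cases b3 <;> cases b4 <;> cases b5 <;> cases b6 <;>
      simp +contextual [h0, h1, h2, h3]
  exists_response c := by
    refine ⟨![c, true, true, false, false, c, !c], rfl, fun g hg => ?_⟩
    simp only [gadgetCount, Fin.sum_univ_seven]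
    fin_cases g <;> cases c <;> simp_all [tableAdj, tableZero]

/-- Up to 3, only the count 1 forbids production. Leaf 4 negates 3, and leaves 5 and 6 negate 1. If
3 were idle, 4 would produce and 1, 2 would have to be idle; then 5 and 6 would force 1 to produce.
So 3 produces and 1, 2 agree. If both were idle, vertex 1 would see 3 producers when 0 is idle, and
vertex 2 would see 2 when 0 produces, a contradiction either way. Hence both neighbours 1 and 2 of
vertex 0 produce, and the unknown `T 4` and `T 5` play no role. -/
theorem isGadget_tableOne (h0 : T 0 = true) (h1 : T 1 = false) (h2 : T 2 = true)
    (h3 : T 3 = true) : IsGadget T fun g g' => tableAdj tableOne g g' where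
  symm := by decide
  irrefl := by decide
  count_zero b hb := by
    have e1 := hb 1 (by decide)
    have e2 := hb 2 (by decide)
    have e3 := hb 3 (by decide)
    have e4 := hb 4 (by decide)
    have e5 := hb 5 (by decide)
    have e6 := hb 6 (by decide)
    simp only [gadgetCount, Fin.sum_univ_seven] at e1 e2 e3 e4 e5 e6 ⊢
    simp [tableAdj, tableOne] at e1 e2 e3 e4 e5 e6 ⊢
    generalize b 0 = b0 at *
    generalize b 1 = b1 at *
    generalize b 2 = b2 at *
    generalize b 3 = b3 at *
    generalize b 4 = b4 at *
    generalize b 5 = b5 at *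
    generalize b 6 = b6 at *
    clear hb
    revert e1 e2 e3 e4 e5 e6
    cases b0 <;> cases b1 <;> cases b2 <;> cases b3 <;> cases b4 <;> cases b5 <;> cases b6 <;>
      simp +contextual [h0, h1, h2, h3]
  exists_response c := by
    refine ⟨![c, true, true, true, false, false, false], rfl, fun g hg => ?_⟩
    simp only [gadgetCount, Fin.sum_univ_seven]
    fin_cases g <;> cases c <;> simp_all [tableAdj, tableOne]

/-! ### The graph of the reduction -/

/-- The graph `G` with a copy of the gadget `H` attached to every vertex `v`, which becomes the
vertex `0` of its copy. -/
def attach {V : Type} (G : SimpleGraph V) (H : Fin 7 → Fin 7 → Bool) (hs : ∀ g g', H g g' = H g' g)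
    (hi : ∀ g, H g g = false) : SimpleGraph (V × Fin 7) where
  Adj p q := (p.2 = 0 ∧ q.2 = 0 ∧ G.Adj p.1 q.1) ∨ (p.1 = q.1 ∧ H p.2 q.2 = true)
  symm := ⟨by
    rintro p q (⟨h1, h2, h3⟩ | ⟨h1, h2⟩)
    · exact .inl ⟨h2, h1, h3.symm⟩
    · exact .inr ⟨h1.symm, by rw [hs, h2]⟩⟩
  loopless := ⟨by
    rintro p (⟨_, _, h⟩ | ⟨_, h⟩)
    · exact G.loopless.irrefl _ h
    · simp [hi] at h⟩

section

variable {V : Type} [Fintype V] {G : SimpleGraph V} {H : Fin 7 → Fin 7 → Bool}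
  {hs : ∀ g g', H g g' = H g' g} {hi : ∀ g, H g g = false}

/-- Neighbours lie either in G, which concerns only `g = 0`, or in the same copy of the gadget. The
two kinds are disjoint because G has no loops. -/
theorem supportCount_attach (s : V × Fin 7 → Bool) (v : V) (g : Fin 7) :
    supportCount (attach G H hs hi) s (v, g) =
      (if g = 0 then supportCount G (fun u => s (u, 0)) v else 0) +
        gadgetCount H (fun g' => s (v, g')) g := by
  classical
  have h1 : gadgetCount H (fun g' => s (v, g')) g =
      (Finset.univ.filter fun q : V × Fin 7 =>
        (v = q.1 ∧ H g q.2 = true) ∧ s q = true).card := by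
    rw [gadgetCount, Finset.card_filter, Fintype.sum_prod_type, Finset.sum_comm]
    refine Finset.sum_congr rfl fun g' _ => ?_
    rw [Finset.sum_eq_single v (fun u _ hu => by simp [hu.symm]) (by simp)]
    cases H g g' <;> cases s (v, g') <;> simp
  have h2 : (if g = 0 then supportCount G (fun u => s (u, 0)) v else 0) =
      (Finset.univ.filter fun q : V × Fin 7 =>
        (g = 0 ∧ q.2 = 0 ∧ G.Adj v q.1) ∧ s q = true).card := by
    rw [Finset.card_filter, Fintype.sum_prod_type, Finset.sum_comm,
      Finset.sum_eq_single 0 (fun g' _ hg' => by simp [hg']) (by simp)]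
    by_cases hg : g = 0
    · rw [if_pos hg, supportCount, Finset.card_filter]
      exact Finset.sum_congr rfl fun u _ => by simp [hg]
    · simp [hg]
  rw [h1, h2, ← Finset.card_union_of_disjoint, ← Finset.filter_or, supportCount]
  · congr 1
    ext q
    have hadj : (attach G H hs hi).Adj (v, g) q ↔
      (g = 0 ∧ q.2 = 0 ∧ G.Adj v q.1) ∨ (v = q.1 ∧ H g q.2 = true) := Iff.rfl
    simp only [Finset.mem_filter, Finset.mem_univ, true_and, hadj]
    tauto
  · rw [Finset.disjoint_filter]
    rintro q _ ⟨⟨rfl, h, h'⟩, _⟩ ⟨⟨rfl, _⟩, _⟩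
    exact G.loopless.irrefl _ h'

theorem exists_isNTPNE_attach {T T' : Pattern} (hT : T 0 = true) (hshift : IsShiftedBy 2 T' T)
    (hH : IsGadget T' H) :
    (∃ s, IsNTPNE T' (attach G H hs hi) s) ↔ ∃ s, IsNTPNE T G s := by
  constructor
  · rintro ⟨s, hs', ⟨v, g⟩, -⟩
    have hpne : IsPNE T G fun u => s (u, 0) := by
      intro u
      have h0 := hs' (u, 0)
      rw [supportCount_attach, if_pos rfl, hH.count_zero, hshift] at h0
      · exact h0
      · intro g hg
        have h := hs' (u, g)
        rwa [supportCount_attach, if_neg hg, zero_add] at h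
    -- The given producer `(v, g)` may lie inside a gadget; it serves only to show that G has a
    -- vertex `v`. If nobody in G produced, `v` would see no producer and `T 0 = true` would make it
    -- produce.
    refine ⟨_, hpne, ?_⟩
    by_contra hne
    have hne' : ∀ u, s (u, 0) = false := fun u => by
      by_contra h
      exact hne ⟨u, by simpa using h⟩
    have := hpne v
    simp [supportCount, hne', hT] at this
  · rintro ⟨s, hs', v, hv⟩
    choose b hb hb' using fun v => hH.exists_response (s v)
    refine ⟨fun p => b p.1 p.2, ?_, (v, 0), by simpa [hb] using hv⟩
    rintro ⟨u, g⟩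
    rw [supportCount_attach]
    by_cases hg : g = 0
    · subst hg
      rw [if_pos rfl, hH.count_zero _ (hb' u), hshift]
      simpa [hb] using hs' u
    · rw [if_neg hg, zero_add]
      exact hb' u g hg

end

/-- Non-trivial equilibria do not depend on the names of the vertices. -/
theorem exists_isNTPNE_comap {V W : Type} [Fintype V] [Fintype W] {T : Pattern} (e : V ≃ W)
    (G : SimpleGraph W) : (∃ s, IsNTPNE T (G.comap e) s) ↔ ∃ s, IsNTPNE T G s := by
  classical
  have hc : ∀ (s : W → Bool) (v : V),
      supportCount (G.comap e) (s ∘ e) v = supportCount G s (e v) := by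
    intro s v
    unfold supportCount
    refine Finset.card_equiv e fun j => ?_
    simp
  constructor
  · rintro ⟨s, h, v, hv⟩
    obtain ⟨s, rfl⟩ : ∃ s', s = s' ∘ e := ⟨s ∘ e.symm, by ext; simp⟩
    refine ⟨s, fun w => ?_, e v, hv⟩
    have := h (e.symm w)
    rw [hc] at this
    simpa using this
  · rintro ⟨s, h, w, hw⟩
    exact ⟨s ∘ e, fun v => by rw [hc]; exact h (e v), e.symm w, by simpa using hw⟩

/-! ### Strings that represent graphs -/

/-- The `m × k` matrix with entries `a i j`, row by row. -/
def rows (m k : ℕ) (a : ℕ → ℕ → Bool) : List Bool :=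
  (List.range m).flatMap fun i => (List.range k).map (a i)

theorem rows_eq_map (m k : ℕ) (a : ℕ → ℕ → Bool) :
    rows m k a = (List.range (m * k)).map fun t => a (t / k) (t % k) := by
  induction m with
  | zero => simp [rows]
  | succ m ih =>
    rw [rows, List.range_succ, List.flatMap_append, Nat.add_one_mul, List.range_add,
      List.map_append]
    refine congrArg₂ _ ih ?_
    rw [List.flatMap_singleton, List.map_map]
    refine List.map_congr_left fun j hj => ?_
    have hj' := List.mem_range.1 hj
    change a m j = a ((m * k + j) / k) ((m * k + j) % k)
    rw [Nat.mul_comm m k, Nat.mul_add_div (by omega), Nat.mul_add_mod, Nat.div_eq_of_lt hj',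
      Nat.mod_eq_of_lt hj', Nat.add_zero]

/-- The string representing the graph on `0, …, n - 1` with adjacency matrix `a`. -/
def graphString (n : ℕ) (a : ℕ → ℕ → Bool) : List Bool :=
  List.replicate n true ++ false :: rows n n a

/-- The number of leading ones. -/
def lead (x : List Bool) : ℕ := (fun k => bif x.getD k false then k + 1 else k)^[x.length] 0

/-- The entries of the adjacency matrix of the graph represented by `x`. -/
def stringAdj (x : List Bool) (i j : ℕ) : Bool := x.getD (lead x + 1 + (i * lead x + j)) false

/-- Whether `x` represents a graph. -/
def isGraph (x : List Bool) : Bool :=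
  x.length == lead x + 1 + lead x * lead x && ((List.range (lead x)).all (fun i => x.getD i false) &&
    (!x.getD (lead x) false && (List.range (lead x)).all fun i => !stringAdj x i i &&
      (List.range (lead x)).all fun j => stringAdj x i j == stringAdj x j i))

section

variable (n : ℕ) (a : ℕ → ℕ → Bool)

theorem length_graphString : (graphString n a).length = n + 1 + n * n := by
  simp [graphString, rows_eq_map]; ring

theorem getD_graphString_lt {i : ℕ} (hi : i < n) : (graphString n a).getD i false = true := by
  rw [graphString, List.getD_append _ _ _ _ (by simpa using hi),
    List.getD_eq_getElem _ _ (by simpa using hi)]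
  simp

theorem getD_graphString_self : (graphString n a).getD n false = false := by
  rw [graphString, List.getD_append_right _ _ _ _ (by simp)]
  simp

theorem getD_graphString {i j : ℕ} (hi : i < n) (hj : j < n) :
    (graphString n a).getD (n + 1 + (i * n + j)) false = a i j := by
  have h : i * n + j < n * n := by nlinarith
  rw [graphString, List.getD_append_right _ _ _ _ (by simp; omega), List.length_replicate,
    show n + 1 + (i * n + j) - n = (i * n + j) + 1 by omega, List.getD_cons_succ, rows_eq_map,
    List.getD_eq_getElem _ _ (by simpa using h), List.getElem_map, List.getElem_range,
    Nat.mul_comm i n, Nat.mul_add_div (by omega), Nat.mul_add_mod, Nat.div_eq_of_lt hj,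
    Nat.mod_eq_of_lt hj, Nat.add_zero]

/-- The counter advances through the `n` ones and is then stuck at the delimiter, so the remaining
`1 + n * n` iterations change nothing. -/
theorem lead_graphString : lead (graphString n a) = n := by
  set x := graphString n a with hx
  have h1 : ∀ i ≤ n, (fun k => bif x.getD k false then k + 1 else k)^[i] 0 = i := by
    intro i hi
    induction i with
    | zero => rfl
    | succ i ih =>
      rw [Function.iterate_succ_apply', ih (by omega), hx, getD_graphString_lt n a (by omega)]
      rfl
  rw [lead, hx, length_graphString, ← hx, show n + 1 + n * n = (1 + n * n) + n by ring,
    Function.iterate_add_apply, h1 n le_rfl]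
  exact Function.iterate_fixed (by rw [hx, getD_graphString_self]; rfl) _

variable {n a}

theorem stringAdj_graphString {i j : ℕ} (hi : i < n) (hj : j < n) :
    stringAdj (graphString n a) i j = a i j := by
  rw [stringAdj, lead_graphString, getD_graphString n a hi hj]

theorem eq_graphString_of_isGraph {x : List Bool} (h : isGraph x = true) :
    x = graphString (lead x) (stringAdj x) := by
  simp only [isGraph, Bool.and_eq_true, beq_iff_eq, List.all_eq_true, List.mem_range,
    Bool.not_eq_true'] at h
  obtain ⟨h1, h2, h3, -⟩ := h
  refine List.ext_getElem (by rw [h1, length_graphString]) fun k hk hk' => ?_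
  rw [← List.getD_eq_getElem _ false hk, ← List.getD_eq_getElem _ false hk']
  rcases lt_trichotomy k (lead x) with h | h | h
  · rw [h2 k h, getD_graphString_lt _ _ h]
  · rw [h, h3, getD_graphString_self]
  · obtain ⟨t, rfl⟩ := Nat.exists_eq_add_of_lt h
    -- For the empty graph the string consists of the delimiter alone, so no position lies beyond
    -- it; otherwise division by `lead x` recovers row and column.
    have hn : 0 < lead x := by
      by_contra h0
      have h0 : lead x = 0 := by omega
      rw [h1, h0] at hk
      omega
    have ht : t < lead x * lead x := by omega
    have e : t = t / lead x * lead x + t % lead x := (Nat.div_add_mod' t _).symm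
    rw [Nat.add_right_comm, e, getD_graphString _ _ (Nat.div_lt_of_lt_mul ht) (Nat.mod_lt _ hn),
      stringAdj]

theorem encodeGraph_eq {G : SimpleGraph (Fin n)} (h : ∀ i j : Fin n, G.Adj i j ↔ a i j = true) :
    encodeGraph G = graphString n a := by
  rw [encodeGraph, graphString, rows, ← List.map_coe_finRange_eq_range, List.flatMap_map]
  congr 3
  funext i
  rw [List.map_map]
  refine List.map_congr_left fun j _ => ?_
  rw [Bool.eq_iff_iff]
  simp [h]

theorem exists_encodeGraph_eq (G : SimpleGraph (Fin n)) : ∃ a : ℕ → ℕ → Bool,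
    encodeGraph G = graphString n a ∧ ∀ i j : Fin n, G.Adj i j ↔ a i j = true := by
  classical
  refine ⟨fun i j => if h : i < n ∧ j < n then decide (G.Adj ⟨i, h.1⟩ ⟨j, h.2⟩) else false,
    encodeGraph_eq fun i j => ?_, fun i j => ?_⟩ <;> simp

theorem isGraph_encodeGraph (G : SimpleGraph (Fin n)) : isGraph (encodeGraph G) = true := by
  obtain ⟨a, h, ha⟩ := exists_encodeGraph_eq G
  rw [h]
  simp only [isGraph, Bool.and_eq_true, beq_iff_eq, List.all_eq_true, List.mem_range,
    Bool.not_eq_true', lead_graphString, length_graphString, getD_graphString_self, true_and]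
  refine ⟨fun i hi => getD_graphString_lt _ _ hi, fun i hi => ⟨?_, fun j hj => ?_⟩⟩
  · rw [stringAdj_graphString hi hi, ← Bool.not_eq_true]
    exact fun h => G.loopless.irrefl _ ((ha ⟨i, hi⟩ ⟨i, hi⟩).2 h)
  · rw [stringAdj_graphString hi hj, stringAdj_graphString hj hi, Bool.eq_iff_iff,
      ← ha ⟨i, hi⟩ ⟨j, hj⟩, ← ha ⟨j, hj⟩ ⟨i, hi⟩, G.adj_comm]

/-- The graph represented by `x`. -/
def stringGraph (x : List Bool) (h : isGraph x = true) : SimpleGraph (Fin (lead x)) where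
  Adj i j := stringAdj x i j = true
  symm := ⟨fun i j hij => by
    simp only [isGraph, Bool.and_eq_true, beq_iff_eq, List.all_eq_true, List.mem_range] at h
    rw [← (h.2.2.2 i i.2).2 j j.2, hij]⟩
  loopless := ⟨fun i hi => by
    simp only [isGraph, Bool.and_eq_true, beq_iff_eq, List.all_eq_true, List.mem_range] at h
    simpa [hi] using (h.2.2.2 i i.2).1⟩

theorem encodeGraph_stringGraph (x : List Bool) (h : isGraph x = true) :
    encodeGraph (stringGraph x h) = x :=
  (encodeGraph_eq fun _ _ => Iff.rfl).trans (eq_graphString_of_isGraph h).symm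

/-- The encoding is injective: `lead` recovers the number of vertices and `stringAdj` the adjacency.
-/
theorem encodeGraph_mem_NTPNE {T : Pattern} {G : SimpleGraph (Fin n)} :
    encodeGraph G ∈ NTPNE T ↔ ∃ s, IsNTPNE T G s := by
  constructor
  · rintro ⟨m, G', h, hG'⟩
    obtain ⟨a, e, ha⟩ := exists_encodeGraph_eq G
    obtain ⟨a', e', ha'⟩ := exists_encodeGraph_eq G'
    rw [e, e'] at h
    have hmn : n = m := by rw [← lead_graphString n a, h, lead_graphString]
    subst hmn
    have : G' = G := by
      ext i j
      rw [ha, ha', ← stringAdj_graphString (a := a') i.2 j.2, ← h, stringAdj_graphString i.2 j.2]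
    exact this ▸ hG'
  · exact fun h => ⟨n, G, rfl, h⟩

theorem mem_NTPNE_iff {T : Pattern} {x : List Bool} :
    x ∈ NTPNE T ↔ ∃ h : isGraph x = true, ∃ s, IsNTPNE T (stringGraph x h) s := by
  constructor
  · intro hx
    have h : isGraph x = true := by
      obtain ⟨n, G, rfl, -⟩ := hx
      exact isGraph_encodeGraph G
    refine ⟨h, ?_⟩
    rw [← encodeGraph_mem_NTPNE, encodeGraph_stringGraph]
    exact hx
  · rintro ⟨h, hs⟩
    rw [← encodeGraph_mem_NTPNE, encodeGraph_stringGraph] at hs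
    exact hs

end

/-! ### The reduction -/

/-- The string of the graph with gadgets. -/
def reduction (tab x : List Bool) : List Bool :=
  bif isGraph x then
    graphString (lead x * 7) fun p q =>
      ((p % 7 == 0 && q % 7 == 0) && stringAdj x (p / 7) (q / 7)) ||
        (p / 7 == q / 7 && tableAdj tab (p % 7) (q % 7))
  else []

/-- Vertex `(v, g)` gets the number `7 * v + g`, so quotient and remainder by 7 recover the pair.
Strings that are not graphs go to the empty string, which encodes no graph since even the empty
graph has a delimiter. -/
theorem mem_NTPNE_iff_reduction {T T' : Pattern} (hT : T 0 = true) (hshift : IsShiftedBy 2 T' T)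
    {tab : List Bool} (h : IsGadget T' fun g g' => tableAdj tab g g') (x : List Bool) :
    x ∈ NTPNE T ↔ reduction tab x ∈ NTPNE T' := by
  rw [mem_NTPNE_iff]
  by_cases hx : isGraph x = true
  · have e : reduction tab x =
        encodeGraph ((attach (stringGraph x hx) _ h.symm h.irrefl).comap finProdFinEquiv.symm) := by
      rw [reduction, hx, cond_true]
      refine (encodeGraph_eq fun p q => ?_).symm
      change ((p.modNat = 0 ∧ q.modNat = 0 ∧ stringAdj x p.divNat q.divNat = true) ∨
        (p.divNat = q.divNat ∧ tableAdj tab p.modNat q.modNat = true)) ↔ _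
      simp only [Bool.or_eq_true, Bool.and_eq_true, beq_iff_eq, Fin.ext_iff, Fin.coe_divNat,
        Fin.coe_modNat, Fin.val_zero, and_assoc]
    rw [e, encodeGraph_mem_NTPNE, exists_isNTPNE_comap, exists_isNTPNE_attach hT hshift h]
    exact ⟨fun ⟨_, h⟩ => h, fun h => ⟨hx, h⟩⟩
  · have hn : isGraph ([] : List Bool) = false := by decide
    have e : reduction tab x = [] := by
      rw [reduction, Bool.eq_false_of_not_eq_true hx, cond_false]
    rw [e, mem_NTPNE_iff]
    exact ⟨fun ⟨h, _⟩ => absurd h hx, fun ⟨h, _⟩ => absurd h (by simp [hn])⟩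

/-! ### Polynomial time of the reduction -/

section

variable {α : Type} [Rep α] {f g : α → Bool} {m n : α → ℕ} {l : α → List Bool}

@[fun_prop]
theorem PolyTime.lead (hl : PolyTime l) : PolyTime fun a => lead (l a) := by
  refine PolyTime.comp (g := PublicGoods.lead) ?_ hl
  refine PolyTime.iterate (α := List Bool) (β := ℕ) (n := List.length) (init := fun _ => 0)
    (step := fun x k => bif x.getD k false then k + 1 else k) (by fun_prop) (by fun_prop)
    (by fun_prop) .self fun x i hi => ?_
  rw [size_nat, size_list]
  refine le_trans ?_ hi
  clear hi
  induction i with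
  | zero => exact le_rfl
  | succ i ih =>
    rw [Function.iterate_succ_apply']
    cases x.getD ((fun k => bif x.getD k false then k + 1 else k)^[i] 0) false
    · exact ih.trans (by omega)
    · simpa using ih

@[fun_prop]
theorem PolyTime.stringAdj (hl : PolyTime l) (hm : PolyTime m) (hn : PolyTime n) :
    PolyTime fun a => stringAdj (l a) (m a) (n a) := by
  unfold PublicGoods.stringAdj
  fun_prop

theorem polyTime_isGraph : PolyTime isGraph := by
  unfold isGraph
  have h1 : PolyTime fun x : List Bool => (List.range (lead x)).all (fun i => x.getD i false) :=
    PolyTime.all_range (by fun_prop) (by fun_prop)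
  have h2 : PolyTime fun p : List Bool × ℕ => (List.range (lead p.1)).all fun j =>
      PublicGoods.stringAdj p.1 p.2 j == PublicGoods.stringAdj p.1 j p.2 :=
    PolyTime.all_range (by fun_prop) (by fun_prop)
  have h3 : PolyTime fun x : List Bool => (List.range (lead x)).all fun i =>
      !PublicGoods.stringAdj x i i && (List.range (lead x)).all fun j =>
        PublicGoods.stringAdj x i j == PublicGoods.stringAdj x j i :=
    PolyTime.all_range (by fun_prop) (by fun_prop)
  fun_prop

@[fun_prop]
theorem PolyTime.or (hf : PolyTime f) (hg : PolyTime g) : PolyTime fun a => f a || g a :=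
  (hf.cond (.const true) hg).congr fun a => by cases f a <;> rfl

@[fun_prop]
theorem PolyTime.div_const (hn : PolyTime n) (k : ℕ) : PolyTime fun a => n a / k := by
  rcases Nat.eq_zero_or_pos k with rfl | hk
  · simp only [Nat.div_zero]
    fun_prop
  · refine (PolyTime.countP_range (p := fun a j => (j + 1) * k - n a == 0) hn
      (by fun_prop)).congr fun a => ?_
    -- The quotient by `k` counts the `j` with `(j + 1) * k ≤ n a`. The range length is varied
    -- independently of `n a` for the induction; at `n a` the minimum is the quotient.
    have h : ∀ i, (List.range i).countP (fun j => (j + 1) * k - n a == 0) = min i (n a / k) := by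
      intro i
      induction i with
      | zero => simp
      | succ i ih =>
        have h' : ((i + 1) * k - n a == 0) = decide (i + 1 ≤ n a / k) := by
          rw [Bool.eq_iff_iff, beq_iff_eq, decide_eq_true_iff, Nat.le_div_iff_mul_le hk]
          omega
        rw [List.range_succ, List.countP_append, ih, List.countP_singleton, h']
        by_cases h : i + 1 ≤ n a / k <;> simp [h] <;> omega
    rw [h]
    exact Nat.min_eq_right (Nat.div_le_self _ _)

@[fun_prop]
theorem PolyTime.mod_const (hn : PolyTime n) (k : ℕ) : PolyTime fun a => n a % k :=
  (show PolyTime fun a => n a - k * (n a / k) by fun_prop).congr fun a =>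
    (Nat.mod_eq_sub_mul_div ..).symm

theorem PolyTime.graphString {b : α → ℕ → ℕ → Bool} (hn : PolyTime n)
    (hb : PolyTime fun p : (α × ℕ) × ℕ => b p.1.1 p.1.2 p.2) :
    PolyTime fun a => graphString (n a) (b a) := by
  have h1 : PolyTime fun p : α × ℕ => (List.range (n p.1)).flatMap fun j => [b p.1 p.2 j] :=
    PolyTime.flatMap_range (by fun_prop) (hb.cons (.const []))
  have h2 := PolyTime.flatMap_range hn (g := fun a i =>
    (List.range (n a)).flatMap fun j => [b a i j]) h1
  exact (hn.replicate_true.append ((PolyTime.const false).cons h2)).congr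
    fun a => by simp only [PublicGoods.graphString, rows, List.map_eq_flatMap]

theorem polyTime_reduction (tab : List Bool) : PolyTime (reduction tab) := by
  have h := polyTime_isGraph
  have h1 : PolyTime fun x => graphString (lead x * 7) fun p q =>
      ((p % 7 == 0 && q % 7 == 0) && PublicGoods.stringAdj x (p / 7) (q / 7)) ||
        (p / 7 == q / 7 && tableAdj tab (p % 7) (q % 7)) := by
    unfold tableAdj
    exact PolyTime.graphString (by fun_prop) (by fun_prop)
  exact h.cond h1 (.const [])

end

/-! ### The verifier -/

/-- Whether `x` represents a graph and `w` a non-trivial equilibrium. -/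
def verifier (T : Pattern) (p : List Bool × List Bool) : Bool :=
  isGraph p.1 && ((List.range (lead p.1)).all (fun i => p.2.getD i false ==
      T ((List.range (lead p.1)).countP fun j => stringAdj p.1 i j && p.2.getD j false)) &&
    (List.range (lead p.1)).any fun i => p.2.getD i false)

theorem polyTime_verifier {T : ℕ → Bool} (hT : PolyTime T) : PolyTime (verifier T) := by
  have h0 := polyTime_isGraph
  have h1 : PolyTime fun p : (List Bool × List Bool) × ℕ => (List.range (lead p.1.1)).countP
      fun j => stringAdj p.1.1 p.2 j && p.1.2.getD j false :=
    PolyTime.countP_range (by fun_prop) (by fun_prop)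
  have h2 : PolyTime fun p : List Bool × List Bool => (List.range (lead p.1)).all fun i =>
      p.2.getD i false ==
        T ((List.range (lead p.1)).countP fun j => stringAdj p.1 i j && p.2.getD j false) :=
    PolyTime.all_range (by fun_prop) (by fun_prop)
  have h3 : PolyTime fun p : List Bool × List Bool => (List.range (lead p.1)).any fun i =>
      p.2.getD i false := PolyTime.any_range (by fun_prop) (by fun_prop)
  unfold verifier
  fun_prop

theorem card_filter_fin {n : ℕ} (P : Fin n → Prop) [DecidablePred P] (p : ℕ → Bool)
    (h : ∀ i : Fin n, P i ↔ p i = true) :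
    (Finset.univ.filter P).card = (List.range n).countP p := by
  rw [← List.map_coe_finRange_eq_range, List.countP_map, ← List.toFinset_finRange,
    (List.nodup_finRange n).card_eq_countP]
  exact List.countP_congr fun i _ => by simp [h]

/-- Missing certificate letters count as `false` and surplus ones are ignored, so every string `w`
describes a profile and its length needs no check. -/
theorem verifier_eq_true_iff {T : Pattern} {x w : List Bool} :
    verifier T (x, w) = true ↔ ∃ h : isGraph x = true,
      IsNTPNE T (stringGraph x h) fun i => w.getD i false := by
  classical
  have hc : ∀ (h : isGraph x = true) (i : Fin (lead x)),
      supportCount (stringGraph x h) (fun i => w.getD i false) i =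
        (List.range (lead x)).countP fun j => stringAdj x i j && w.getD j false :=
    fun h i => by
      rw [supportCount]
      exact card_filter_fin _ _ fun j => by simp [stringGraph]
  simp only [verifier, Bool.and_eq_true, List.all_eq_true, List.any_eq_true, List.mem_range,
    beq_iff_eq, IsNTPNE, IsPNE]
  constructor
  · rintro ⟨h, h1, i, hi, h2⟩
    exact ⟨h, fun i => by rw [hc]; exact h1 i i.2, ⟨i, hi⟩, h2⟩
  · rintro ⟨h, h1, i, h2⟩
    exact ⟨h, fun i hi => by rw [← hc h ⟨i, hi⟩]; exact h1 ⟨i, hi⟩, i, i.2, h2⟩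

theorem inNP_NTPNE {T : Pattern} (hT : PolyTime T) : InNP (NTPNE T) := by
  refine ⟨verifier T, Polynomial.X, polyTimeVerifier_of_polyTime (polyTime_verifier hT),
    fun x => ?_⟩
  simp only [verifier_eq_true_iff, Polynomial.eval_X]
  rw [mem_NTPNE_iff]
  constructor
  · rintro ⟨h, s, hs⟩
    -- A graph string has length at least its number of vertices, so the polynomial `X` bounds the
    -- certificate.
    refine ⟨List.ofFn s, ?_, h, ?_⟩
    · have h' := h
      simp only [isGraph, Bool.and_eq_true, beq_iff_eq] at h'
      rw [List.length_ofFn, h'.1]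
      omega
    · have : (fun i : Fin (lead x) => (List.ofFn s).getD i false) = s := by
        funext i
        rw [List.getD_eq_getElem _ _ (by simp), List.getElem_ofFn]
      rwa [this]
  · rintro ⟨w, -, h, hw⟩
    exact ⟨h, _, hw⟩

/-- Only two values are prepended; the truncation in `k - 2` affects only arguments already handled
separately. -/
theorem polyTime_of_shift {T T' : ℕ → Bool} (hshift : IsShiftedBy 2 T' T) (hsharp : IsSharp T')
    (hT : PolyTime T) : PolyTime T' := by
  refine (show PolyTime fun k => bif k == 0 then true else bif k == 1 then false else T (k - 2) by
    fun_prop).congr fun k => ?_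
  match k with
  | 0 => exact hsharp.1.symm
  | 1 => exact hsharp.2.symm
  | k + 2 => exact (hshift k).symm

theorem PolyTimeReducible.trans {A B C : Language Bool} (h : PolyTimeReducible A B)
    (h' : PolyTimeReducible B C) : PolyTimeReducible A C :=
  let ⟨f, hf, hf'⟩ := h
  let ⟨g, hg, hg'⟩ := h'
  ⟨fun x => g (f x), computable_comp hg hf, fun x => (hf' x).trans (hg' (f x))⟩

theorem polyTimeReducible_of_shift {T T' : Pattern} (hT : ¬ IsFlat T)
    (hshift : IsShiftedBy 2 T' T) (hsharp : IsSharp T') :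
    PolyTimeReducible (NTPNE T) (NTPNE T') := by
  have h0 : T 0 = true := by simpa [IsFlat] using hT
  have h2 : T' 2 = true := (hshift 0).trans h0
  obtain ⟨tab, h⟩ : ∃ tab, IsGadget T' fun g g' => tableAdj tab g g' := by
    cases h3 : T' 3
    · exact ⟨_, isGadget_tableZero hsharp.1 hsharp.2 h2 h3⟩
    · exact ⟨_, isGadget_tableOne hsharp.1 hsharp.2 h2 h3⟩
  exact ⟨reduction tab, polyTime_reduction tab, mem_NTPNE_iff_reduction h0 hshift h⟩

end PublicGoods

theorem theorem6 (T T' : PublicGoods.Pattern)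
    (hT : ¬ PublicGoods.IsFlat T)
    (hshift : PublicGoods.IsShiftedBy 2 T' T)
    (hsharp : PublicGoods.IsSharp T') :
    PublicGoods.PolyTimeReducible (PublicGoods.NTPNE T) (PublicGoods.NTPNE T') ∧
      (PublicGoods.NPComplete (PublicGoods.NTPNE T) →
        PublicGoods.NPHard (PublicGoods.NTPNE T') ∧
          (PublicGoods.PolyTimePattern T →
            PublicGoods.NPComplete (PublicGoods.NTPNE T'))) := by
  have h := PublicGoods.polyTimeReducible_of_shift hT hshift hsharp
  refine ⟨h, fun hc => ?_⟩
  have hh : PublicGoods.NPHard (PublicGoods.NTPNE T') := fun A hA => (hc.2 A hA).trans h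
  exact ⟨hh, fun hp =>
    ⟨PublicGoods.inNP_NTPNE (PublicGoods.polyTime_of_shift hshift hsharp hp), hh⟩⟩
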